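/- Let $n,p\ge 1$ be integers, $\delta=n/p$, $\theta^*\in\mathbb R^p$, $\lambda>0$, $\sigma^2>0$, and let $\Sigma\in\mathbb R^{p\times p}$ be symmetric positive definite, with symmetric positive definite square root $\Sigma^{1/2}$. Let $g\sim\mathsf N(0,I_p)$. For $y\in\mathbb R^p$ and $\zeta\ge 0$ put $$\eta(y,\zeta)=\arg\min_{\theta\in\mathbb R^p}\Big\{\tfrac{\zeta}{2}\|y-\Sigma^{1/2}\theta\|_2^2+\lambda\|\theta\|_1\Big\},\qquad \widehat y(y,\zeta)=\Sigma^{1/2}\eta(y,\zeta),$$ and for $\tau>0$ $$\mathsf R(\tau^2,\zeta)=\tfrac1n\,\mathbb E\,\|\widehat y(\Sigma^{1/2}\theta^*+\tau g,\zeta)-\Sigma^{1/2}\theta^*\|_2^2,\qquad \mathsf{df}(\tau^2,\zeta)=\tfrac1{n\tau}\,\mathbb E\,\langle\widehat y(\Sigma^{1/2}\theta^*+\tau g,\zeta),g\rangle .$$ The fixed point equations, in the unknowns $\tau>0$ and $\zeta\ge0$, are $$\tau^2=\sigma^2+\mathsf R(\tau^2,\zeta),\qquad \zeta=1-\mathsf{df}(\tau^2,\zeta).\tag{1}$$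 For $x\in\{-1,0,1\}^p$ with support $S$ and $v\in\mathbb R^p$ let $F(v;x,\Sigma)=\langle x,\Sigma^{-1/2}v\rangle+\|(\Sigma^{-1/2}v)_{S^c}\|_1$, and define the functional Gaussian width $$\mathcal G(x,\Sigma)=\sup\Big\{\tfrac1p\,\mathbb E\langle v(g),g\rangle:\ v:\mathbb R^p\to\mathbb R^p,\ \mathbb E\|v(g)\|_2^2\le p,\ \mathbb E\,F(v(g);x,\Sigma)\le0\Big\}.$$ The vector $\theta^*$ is called $(s,\mathcal G^*,M)$-approximately sparse if there are $x\in\{-1,0,1\}^p$ with exactly $s$ nonzero entries and $\mathcal G(x,\Sigma)\le\mathcal G^*$, and $\bar\theta\in\mathbb R^p$ with $\mathrm{sign}(\bar\theta)=x$ entrywise (where $\mathrm{sign}(0)=0$) and $\frac1p\|\bar\theta-\theta^*\|_1\le M$. **Theorem.** Let $0<\lambda_{\min}\le\lambda_{\max}$, $0<\kappa_{\min}\le\kappa_{\max}$, $0<\sigma_{\min}\le\sigma_{\max}$, $\delta>0$, $\nu_{\min}>0$, $0<\Delta_{\min}\le1$ and $M\ge0$. There exist $0<\tau_{\min}\le\tau_{\max}<\infty$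 and $0<\zeta_{\min}\le\zeta_{\max}<\infty$, depending only on these constants, such that the following holds for all $n,p$ with $n/p=\delta$. If $\lambda_{\min}\le\lambda\le\lambda_{\max}$, all eigenvalues of $\Sigma$ lie in $[\kappa_{\min},\kappa_{\max}]$, $\sigma_{\min}^2\le\sigma^2\le\sigma_{\max}^2$, and $\theta^*$ is $(s,\sqrt\delta(1-\Delta_{\min}),M)$-approximately sparse for some integer $s$ with $s/p\ge\nu_{\min}$, then the equations (1) have a unique solution $(\tau^*,\zeta^*)$, and it satisfies $$\tau_{\min}\le\tau^*\le\tau_{\max},\qquad \zeta_{\min}\le\zeta^*\le\zeta_{\max}.$$ -/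

import Mathlib

open MeasureTheory ProbabilityTheory
open scoped MatrixOrder

noncomputable section

namespace LassoFixedDesign

/-- The action of a real `p × p` matrix on Euclidean `p`-space. -/
abbrev act {p : ℕ} (A : Matrix (Fin p) (Fin p) ℝ) :
    EuclideanSpace ℝ (Fin p) →L[ℝ] EuclideanSpace ℝ (Fin p) :=
  Matrix.toEuclideanCLM (𝕜 := ℝ) A

/-- The `ℓ₁` norm on Euclidean `p`-space. -/
def l1Norm {p : ℕ} (θ : EuclideanSpace ℝ (Fin p)) : ℝ := ∑ j, |θ j|

/-- The standard Gaussian measure `N(0, I_p)`. -/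
abbrev gaussian (p : ℕ) : Measure (EuclideanSpace ℝ (Fin p)) :=
  stdGaussian (EuclideanSpace ℝ (Fin p))

/-! ### The Lasso in the fixed-design model with design matrix `Cov ^ (1/2)`

`CFC.sqrt Cov` is the symmetric positive semidefinite square root of `Cov`. -/

/-- `(ζ / 2) ‖y - Cov ^ (1/2) θ‖₂² + lam ‖θ‖₁`. -/
def lassoObjective {p : ℕ} (Cov : Matrix (Fin p) (Fin p) ℝ) (lam : ℝ)
    (y : EuclideanSpace ℝ (Fin p)) (ζ : ℝ) (θ : EuclideanSpace ℝ (Fin p)) : ℝ :=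
  ζ / 2 * ‖y - act (CFC.sqrt Cov) θ‖ ^ 2 + lam * l1Norm θ

open Classical in
/-- The Lasso estimator `η(y, ζ)`: the minimizer of the Lasso objective. The minimizer exists and
is unique whenever `Cov` is positive definite, `lam > 0` and `ζ ≥ 0`. -/
def lassoEstimator {p : ℕ} (Cov : Matrix (Fin p) (Fin p) ℝ) (lam : ℝ)
    (y : EuclideanSpace ℝ (Fin p)) (ζ : ℝ) : EuclideanSpace ℝ (Fin p) :=
  if h : ∃ θ, ∀ θ', lassoObjective Cov lam y ζ θ ≤ lassoObjective Cov lam y ζ θ'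
  then h.choose else 0

/-- The prediction vector `ŷ(y, ζ) = Cov ^ (1/2) η(y, ζ)`. -/
def prediction {p : ℕ} (Cov : Matrix (Fin p) (Fin p) ℝ) (lam : ℝ)
    (y : EuclideanSpace ℝ (Fin p)) (ζ : ℝ) : EuclideanSpace ℝ (Fin p) :=
  act (CFC.sqrt Cov) (lassoEstimator Cov lam y ζ)

/-- The in-sample prediction risk `R(τ², ζ)` at noise level `τ > 0`:
`(1 / n) 𝔼 ‖ŷ(Cov ^ (1/2) θ + τ g, ζ) - Cov ^ (1/2) θ‖₂²` with `g ∼ N(0, I_p)`. -/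
def risk (n : ℕ) {p : ℕ} (Cov : Matrix (Fin p) (Fin p) ℝ) (lam : ℝ)
    (θ : EuclideanSpace ℝ (Fin p)) (τ ζ : ℝ) : ℝ :=
  1 / (n : ℝ) * ∫ g, ‖prediction Cov lam (act (CFC.sqrt Cov) θ + τ • g) ζ
    - act (CFC.sqrt Cov) θ‖ ^ 2 ∂(gaussian p)

/-- The degrees of freedom `df(τ², ζ)` at noise level `τ > 0`:
`(1 / (n τ)) 𝔼 ⟨ŷ(Cov ^ (1/2) θ + τ g, ζ), g⟩` with `g ∼ N(0, I_p)`. -/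
def degreesOfFreedom (n : ℕ) {p : ℕ} (Cov : Matrix (Fin p) (Fin p) ℝ) (lam : ℝ)
    (θ : EuclideanSpace ℝ (Fin p)) (τ ζ : ℝ) : ℝ :=
  1 / ((n : ℝ) * τ) * ∫ g, inner ℝ
    (prediction Cov lam (act (CFC.sqrt Cov) θ + τ • g) ζ) g ∂(gaussian p)

/-- `(τ, ζ)`, with `τ > 0` and `ζ ≥ 0`, solves the fixed point equations
`τ² = σ² + R(τ², ζ)` and `ζ = 1 - df(τ², ζ)`. -/
def IsFixedPoint (n : ℕ) {p : ℕ} (Cov : Matrix (Fin p) (Fin p) ℝ) (σ lam : ℝ)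
    (θ : EuclideanSpace ℝ (Fin p)) (τ ζ : ℝ) : Prop :=
  0 < τ ∧ 0 ≤ ζ ∧
    τ ^ 2 = σ ^ 2 + risk n Cov lam θ τ ζ ∧
    ζ = 1 - degreesOfFreedom n Cov lam θ τ ζ

/-! ### Approximate sparsity -/

/-- `F(v; x, Cov) = ⟨x, Cov ^ (-1/2) v⟩ + ‖(Cov ^ (-1/2) v)_{Sᶜ}‖₁`, where `S` is the support
of the sign vector `x`. -/
def coneFunctional {p : ℕ} (x : Fin p → SignType) (Cov : Matrix (Fin p) (Fin p) ℝ)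
    (v : EuclideanSpace ℝ (Fin p)) : ℝ :=
  ∑ j, (x j : ℝ) * act (CFC.sqrt Cov)⁻¹ v j
    + ∑ j with x j = 0, |act (CFC.sqrt Cov)⁻¹ v j|

/-- The functional Gaussian width: the supremum of `(1 / p) 𝔼 ⟨v(g), g⟩` over all
`v ∈ L²(ℝᵖ, N(0, I_p); ℝᵖ)` with `‖v‖_{L²}² ≤ p` and `𝔼 F(v(g); x, Cov) ≤ 0`. -/
def gaussianWidth {p : ℕ} (x : Fin p → SignType) (Cov : Matrix (Fin p) (Fin p) ℝ) : ℝ :=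
  sSup {r : ℝ | ∃ v : EuclideanSpace ℝ (Fin p) → EuclideanSpace ℝ (Fin p),
    MemLp v 2 (gaussian p) ∧
    ∫ g, ‖v g‖ ^ 2 ∂(gaussian p) ≤ p ∧
    ∫ g, coneFunctional x Cov (v g) ∂(gaussian p) ≤ 0 ∧
    r = 1 / (p : ℝ) * ∫ g, inner ℝ (v g) g ∂(gaussian p)}

/-- `θ` is `(s, G, M)`-approximately sparse (with respect to `Cov`): for some sign vector `x` with
exactly `s` nonzero entries and functional Gaussian width at most `G`, some vector with entrywise
sign `x` is within `p M` of `θ` in `ℓ₁` norm. -/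
def IsApproxSparse {p : ℕ} (Cov : Matrix (Fin p) (Fin p) ℝ) (θ : EuclideanSpace ℝ (Fin p))
    (s : ℕ) (G M : ℝ) : Prop :=
  ∃ x : Fin p → SignType,
    (∃ θbar : EuclideanSpace ℝ (Fin p),
      1 / (p : ℝ) * l1Norm (θbar - θ) ≤ M ∧ ∀ j, x j = SignType.sign (θbar j)) ∧
    (Finset.univ.filter fun j => x j ≠ 0).card = s ∧
    gaussianWidth x Cov ≤ G

end LassoFixedDesign

end

set_option linter.unusedSectionVars false

/-! The fixed point equations are the first-order conditions of one convex problem. Write `r = 1/n`,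
and for a square-integrable prediction error `v = v(g)` put `T(v) = √(σ² + r‖v‖²)` and `L(v) = T(v)
- r⟨g, v⟩`, with norm and inner product in L² of the Gaussian. Minimize `L(v)₊²/2 + rλ 𝔼‖θ +
Σ^(-1/2) v(g)‖₁`. If `L(v) > 0` at a minimizer, differentiating the square produces the factor `L`,
and the condition is, in integrated form, the optimality condition of the Lasso at noise level `τ =
T(v)` with weight `ζ = L(v)/T(v)`. So `v` is the Lasso prediction error, and the definitions of `T`
and `L` become the two equations (`isFixedPoint_of_isMin`). Conversely the prediction error of any
solution satisfies this condition, and two such errors coincide (`eq_of_variational_inequalities`),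
because `σ ≠ 0` makes the Cauchy–Schwarz inequality between the lifted vectors `(σ, √r v)` strict.

Existence and the uniform bounds rest on two estimates for near-minimizers. Their norm is bounded
(`exists_norm_bound`): comparison with `v = 0` bounds the mean cone functional, so up to a bounded
shift `v` is admissible for the Gaussian width; hence `r⟨g, v⟩` is at most `1 - ΔMin` times `√r ‖v‖`
plus a constant, and `L` grows linearly in `‖v‖`, whereas the cost allows only growth like a square
root. Their `L` is bounded below (`exists_gap_bound`): if `L` were small, shrinking the estimate
would cost almost nothing, so the estimate would already be nearly zero; then `v` is nearly
deterministic, nearly uncorrelated with `g`, and `L` is at least about `σ`. Where both bounds hold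
the cost is strongly convex at midpoints, so minimizing sequences are Cauchy
(`exists_minimizer_cost`). -/

namespace LassoFixedDesign

/-! ### The convex cost on an abstract Hilbert space. -/

section HilbertSpace

variable {H : Type*} [NormedAddCommGroup H] [InnerProductSpace ℝ H]

/-- The effective noise level `√(σ² + r ‖v‖²)` of an estimation error `v`. -/
noncomputable def noiseLevel (σ r : ℝ) (v : H) : ℝ := Real.sqrt (σ ^ 2 + r * ‖v‖ ^ 2)

/-- The effective noise level of `v` minus the normalized correlation of `v` with the noise `g`. -/
noncomputable def gap (σ r : ℝ) (g v : H) : ℝ := noiseLevel σ r v - r * inner ℝ g v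

/-- The convex cost `(gap v)₊² / 2 + N v` whose minimizers solve the fixed point equations. -/
noncomputable def cost (σ r : ℝ) (g : H) (N : H → ℝ) (v : H) : ℝ :=
  max (gap σ r g v) 0 ^ 2 / 2 + N v

variable {σ r : ℝ} {g : H}

lemma noiseLevel_sq (hr : 0 ≤ r) (v : H) : noiseLevel σ r v ^ 2 = σ ^ 2 + r * ‖v‖ ^ 2 :=
  Real.sq_sqrt (by positivity)

lemma noiseLevel_nonneg (v : H) : 0 ≤ noiseLevel σ r v := Real.sqrt_nonneg _

lemma noiseLevel_pos (hσ : 0 < σ ^ 2) (hr : 0 ≤ r) (v : H) : 0 < noiseLevel σ r v :=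
  Real.sqrt_pos.2 (by positivity)

lemma noiseLevel_mono (hr : 0 ≤ r) {v : H} {U : ℝ} (h : ‖v‖ ≤ U) :
    noiseLevel σ r v ≤ Real.sqrt (σ ^ 2 + r * U ^ 2) := by
  unfold noiseLevel; gcongr

lemma continuous_gap : Continuous (gap σ r g) := by
  unfold gap noiseLevel; fun_prop

lemma continuous_cost {N : H → ℝ} (hN : Continuous N) : Continuous (cost σ r g N) := by
  have := continuous_gap (σ := σ) (r := r) (g := g)
  unfold cost; fun_prop

lemma sqrt_mul_norm_le_noiseLevel (hr : 0 ≤ r) (v : H) : Real.sqrt r * ‖v‖ ≤ noiseLevel σ r v := by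
  refine Real.le_sqrt_of_sq_le ?_
  rw [mul_pow, Real.sq_sqrt hr]; nlinarith [sq_nonneg σ]

/-- Cauchy–Schwarz for the lifted vectors `(σ, √r u)` and `(σ, √r v)`, whose lengths are the noise
levels. -/
lemma mul_inner_le_noiseLevel_mul (hr : 0 ≤ r) (u v : H) :
    σ ^ 2 + r * inner ℝ u v ≤ noiseLevel σ r u * noiseLevel σ r v := by
  unfold noiseLevel
  rw [← Real.sqrt_mul (by positivity)]
  refine Real.le_sqrt_of_sq_le ?_
  have h1 := real_inner_mul_inner_self_le u v
  rw [real_inner_self_eq_norm_sq, real_inner_self_eq_norm_sq] at h1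
  have h2 := norm_sub_sq_real u v
  have h3 : 0 ≤ ‖u‖ ^ 2 - 2 * inner ℝ u v + ‖v‖ ^ 2 := h2 ▸ sq_nonneg _
  nlinarith [mul_nonneg (mul_nonneg hr (sq_nonneg σ)) h3,
    mul_nonneg (sq_nonneg r) (sub_nonneg.2 h1)]

/-- The Cauchy–Schwarz deficit of the lifted vectors: their Gram determinant is `rσ²‖u - v‖²` plus
`r²` times that of `u, v`. This is the source of both strong convexity and uniqueness. -/
lemma noiseLevel_mul_sub_ge (hr : 0 ≤ r) (u v : H) :
    r * σ ^ 2 * ‖u - v‖ ^ 2 ≤ 2 * (noiseLevel σ r u * noiseLevel σ r v) *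
      (noiseLevel σ r u * noiseLevel σ r v - (σ ^ 2 + r * inner ℝ u v)) := by
  have h1 := real_inner_mul_inner_self_le u v
  rw [real_inner_self_eq_norm_sq, real_inner_self_eq_norm_sq] at h1
  have h2 := norm_sub_sq_real u v
  have h3 := mul_inner_le_noiseLevel_mul (σ := σ) hr u v
  have h4 : (noiseLevel σ r u * noiseLevel σ r v) ^ 2 =
      (σ ^ 2 + r * ‖u‖ ^ 2) * (σ ^ 2 + r * ‖v‖ ^ 2) := by
    rw [mul_pow, noiseLevel_sq hr, noiseLevel_sq hr]
  have h5 : r * σ ^ 2 * ‖u - v‖ ^ 2 ≤ (noiseLevel σ r u * noiseLevel σ r v) ^ 2 -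
      (σ ^ 2 + r * inner ℝ u v) ^ 2 := by
    rw [h4, h2]; nlinarith [mul_nonneg (sq_nonneg r) (sub_nonneg.2 h1)]
  nlinarith [sq_nonneg (noiseLevel σ r u * noiseLevel σ r v - (σ ^ 2 + r * inner ℝ u v))]

lemma noiseLevel_add_le (hr : 0 ≤ r) (v d : H) :
    noiseLevel σ r (v + d) ≤ noiseLevel σ r v + Real.sqrt r * ‖d‖ := by
  have h0 := noiseLevel_nonneg (σ := σ) (r := r) v
  have hv := sqrt_mul_norm_le_noiseLevel (σ := σ) hr v
  have h3 := real_inner_le_norm v d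
  have hs := Real.sqrt_nonneg r
  rw [noiseLevel, Real.sqrt_le_left (by positivity), norm_add_sq_real, add_sq,
    noiseLevel_sq hr, mul_pow, Real.sq_sqrt hr]
  have h4 : r * inner ℝ v d ≤ noiseLevel σ r v * (Real.sqrt r * ‖d‖) := by
    calc r * inner ℝ v d ≤ r * (‖v‖ * ‖d‖) := by gcongr
      _ = (Real.sqrt r * ‖v‖) * (Real.sqrt r * ‖d‖) := by
        nth_rw 1 [← Real.mul_self_sqrt hr]; ring
      _ ≤ _ := by gcongr
  nlinarith

lemma gap_add_le (hr : 0 ≤ r) (v d : H) :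
    gap σ r g (v + d) ≤ gap σ r g v + (Real.sqrt r + r * ‖g‖) * ‖d‖ := by
  have h1 := noiseLevel_add_le (σ := σ) hr v d
  have h2 := abs_le.1 (abs_real_inner_le_norm g d)
  unfold gap
  rw [inner_add_right]
  nlinarith [mul_le_mul_of_nonneg_left h2.1 hr]

/-- Lifted vectors share the nonzero coordinate `σ`, so distinct ones are never parallel and their
length is strictly convex; the correlation term is linear and contributes nothing. -/
lemma gap_midpoint_le (hσ : 0 < σ ^ 2) (hr : 0 ≤ r) {u v : H} {T : ℝ}
    (hu : noiseLevel σ r u ≤ T) (hv : noiseLevel σ r v ≤ T) :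
    gap σ r g ((1 / 2 : ℝ) • (u + v)) ≤ (gap σ r g u + gap σ r g v) / 2
      - r * σ ^ 2 / (8 * T ^ 3) * ‖u - v‖ ^ 2 := by
  have hu0 := noiseLevel_pos hσ hr u
  have hv0 := noiseLevel_pos hσ hr v
  have hT : 0 < T := hu0.trans_le hu
  set a := noiseLevel σ r u with ha
  set b := noiseLevel σ r v with hb
  have h1 := noiseLevel_mul_sub_ge (σ := σ) hr u v
  rw [← ha, ← hb] at h1
  have h0 := mul_inner_le_noiseLevel_mul (σ := σ) hr u v
  rw [← ha, ← hb] at h0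
  set P := σ ^ 2 + r * inner ℝ u v with hP
  set m := noiseLevel σ r ((1 / 2 : ℝ) • (u + v)) with hm
  have hm0 : 0 ≤ m := noiseLevel_nonneg _
  have hmsq : m ^ 2 = ((a + b) / 2) ^ 2 - (a * b - P) / 2 := by
    have e1 := noiseLevel_sq (σ := σ) hr u
    have e2 := noiseLevel_sq (σ := σ) hr v
    rw [hm, noiseLevel_sq hr, norm_smul, mul_pow, norm_add_sq_real]
    rw [← ha] at e1; rw [← hb] at e2
    norm_num
    nlinarith
  have hmle : m ≤ (a + b) / 2 := by
    refine abs_le_of_sq_le_sq' ?_ (by positivity) |>.2; nlinarith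
  -- The deficit `ab - P` is at least `rσ²‖u - v‖²/(2T²)` and at most `4T((a + b)/2 - m)`, hence the
  -- factor `8T³`.
  have key : r * σ ^ 2 * ‖u - v‖ ^ 2 ≤ 8 * T ^ 3 * ((a + b) / 2 - m) := by
    have hab : a * b ≤ T * T := by gcongr
    have s1 : r * σ ^ 2 * ‖u - v‖ ^ 2 ≤ 2 * (T * T) * (a * b - P) := by
      refine h1.trans ?_
      gcongr
    have s2 : a * b - P = 2 * (((a + b) / 2 - m) * ((a + b) / 2 + m)) := by nlinarith
    have s3 : ((a + b) / 2 - m) * ((a + b) / 2 + m) ≤ ((a + b) / 2 - m) * (2 * T) := by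
      gcongr
      linarith
    rw [s2] at s1
    nlinarith [mul_le_mul_of_nonneg_left s3 (by positivity : 0 ≤ T * T)]
  have : r * σ ^ 2 / (8 * T ^ 3) * ‖u - v‖ ^ 2 ≤ (a + b) / 2 - m := by
    rw [div_mul_eq_mul_div, div_le_iff₀ (by positivity)]; linarith
  unfold gap
  rw [← ha, ← hb, ← hm, inner_smul_right, inner_add_right]
  linarith

/-- On near-minimizers with `gap` bounded below, the cost is strongly convex. -/
lemma cost_midpoint_le (hσ : 0 < σ ^ 2) (hr : 0 ≤ r) {N : H → ℝ}
    (hN : ConvexOn ℝ Set.univ N) {u v : H} {T c : ℝ} (hc : 0 < c)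
    (hu : noiseLevel σ r u ≤ T) (hv : noiseLevel σ r v ≤ T)
    (hgu : c ≤ gap σ r g u) (hgv : c ≤ gap σ r g v)
    (hgm : c ≤ gap σ r g ((1 / 2 : ℝ) • (u + v))) :
    cost σ r g N ((1 / 2 : ℝ) • (u + v)) ≤ (cost σ r g N u + cost σ r g N v) / 2
      - c * (r * σ ^ 2 / (8 * T ^ 3)) / 2 * ‖u - v‖ ^ 2 := by
  have h1 := gap_midpoint_le (g := g) hσ hr hu hv
  have h2 := hN.2 (Set.mem_univ u) (Set.mem_univ v) (by norm_num : (0 : ℝ) ≤ 1 / 2)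
    (by norm_num : (0 : ℝ) ≤ 1 / 2) (by norm_num)
  rw [← smul_add] at h2
  simp only [smul_eq_mul] at h2
  unfold cost
  rw [max_eq_left (hc.le.trans hgu), max_eq_left (hc.le.trans hgv), max_eq_left (hc.le.trans hgm)]
  have hT : 0 < T := (noiseLevel_pos hσ hr u).trans_le hu
  set x := r * σ ^ 2 / (8 * T ^ 3) * ‖u - v‖ ^ 2 with hx
  have hx0 : 0 ≤ x := by positivity
  have e : c * (r * σ ^ 2 / (8 * T ^ 3)) / 2 * ‖u - v‖ ^ 2 = c * x / 2 := by rw [hx]; ring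
  rw [e]
  generalize gap σ r g u = p at *
  generalize gap σ r g v = q at *
  generalize gap σ r g ((1 / 2 : ℝ) • (u + v)) = m at *
  have hm2 : m ^ 2 ≤ ((p + q) / 2) ^ 2 - c * x := by
    have : m * m ≤ ((p + q) / 2 - x) * ((p + q) / 2) :=
      mul_le_mul h1 (by linarith) (by linarith) (by linarith)
    nlinarith
  nlinarith [sq_nonneg (p - q)]

/-- Convexity without any lower bound on `gap`: it makes the midpoint of two near-minimizers a
near-minimizer, so that the lower bound on `gap` applies there too. -/
lemma cost_midpoint_le_average (hσ : 0 < σ ^ 2) (hr : 0 ≤ r) {N : H → ℝ} (hN : ConvexOn ℝ Set.univ N)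
    (u v : H) : cost σ r g N ((1 / 2 : ℝ) • (u + v)) ≤ (cost σ r g N u + cost σ r g N v) / 2 := by
  have h1 := gap_midpoint_le (g := g) hσ hr (le_max_left (noiseLevel σ r u) (noiseLevel σ r v))
    (le_max_right (noiseLevel σ r u) (noiseLevel σ r v))
  have h2 := hN.2 (Set.mem_univ u) (Set.mem_univ v) (by norm_num : (0 : ℝ) ≤ 1 / 2)
    (by norm_num : (0 : ℝ) ≤ 1 / 2) (by norm_num)
  rw [← smul_add] at h2
  simp only [smul_eq_mul] at h2
  have hT : 0 < max (noiseLevel σ r u) (noiseLevel σ r v) :=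
    (noiseLevel_pos hσ hr u).trans_le (le_max_left _ _)
  have hx : 0 ≤ r * σ ^ 2 / (8 * max (noiseLevel σ r u) (noiseLevel σ r v) ^ 3) * ‖u - v‖ ^ 2 := by
    positivity
  have h3 : max (gap σ r g ((1 / 2 : ℝ) • (u + v))) 0 ≤
      (max (gap σ r g u) 0 + max (gap σ r g v) 0) / 2 := by
    refine max_le ?_ (by positivity)
    linarith [le_max_left (gap σ r g u) 0, le_max_left (gap σ r g v) 0]
  have h4 : max (gap σ r g ((1 / 2 : ℝ) • (u + v))) 0 ^ 2 ≤
      ((max (gap σ r g u) 0 + max (gap σ r g v) 0) / 2) ^ 2 := by gcongr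
  unfold cost
  nlinarith [sq_nonneg (max (gap σ r g u) 0 - max (gap σ r g v) 0)]

/-- Direct method without weak compactness: strong midpoint convexity turns closeness of two costs
to the infimum into closeness of the two points. -/
lemma exists_minimizer_cost [CompleteSpace H] (hσ : 0 < σ ^ 2) (hr : 0 < r) {N : H → ℝ}
    (hN : ConvexOn ℝ Set.univ N) (hNc : Continuous N) (hN0 : ∀ v, 0 ≤ N v)
    {U c ε : ℝ} (hc : 0 < c) (hε : 0 < ε)
    (hU : ∀ v, (∀ u, cost σ r g N v ≤ cost σ r g N u + ε) → ‖v‖ ≤ U)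
    (hL : ∀ v, (∀ u, cost σ r g N v ≤ cost σ r g N u + ε) → c ≤ gap σ r g v) :
    ∃ v, ∀ u, cost σ r g N v ≤ cost σ r g N u := by
  set E := cost σ r g N with hE
  have hbdd : BddBelow (Set.range E) :=
    ⟨0, by rintro _ ⟨v, rfl⟩; exact add_nonneg (by positivity) (hN0 v)⟩
  set m := ⨅ v, E v with hm
  have hmle : ∀ u, m ≤ E u := fun u => ciInf_le hbdd u
  have hex : ∀ k : ℕ, ∃ v, E v < m + ε / (k + 1) := fun k =>
    exists_lt_of_ciInf_lt (lt_add_of_pos_right _ (by positivity))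
  choose v hv using hex
  have hnear : ∀ k u, E (v k) ≤ E u + ε := fun k u => by
    have : ε / ((k : ℝ) + 1) ≤ ε := div_le_self hε.le (by linarith [Nat.cast_nonneg (α := ℝ) k])
    linarith [hv k, hmle u]
  set T := Real.sqrt (σ ^ 2 + r * U ^ 2) with hT
  set K := c * (r * σ ^ 2 / (8 * T ^ 3)) / 2 with hK
  have hT0 : 0 < T := (noiseLevel_pos hσ hr.le (v 0)).trans_le
    (noiseLevel_mono hr.le (hU _ (hnear 0)))
  have hK0 : 0 < K := by positivity
  have hdist : ∀ i j n : ℕ, n ≤ i → n ≤ j → dist (v i) (v j) ≤ Real.sqrt (ε / (n + 1) / K) := by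
    intro i j n hi hj
    have hb : ∀ k : ℕ, n ≤ k → E (v k) ≤ m + ε / (n + 1) := fun k hk => by
      refine (hv k).le.trans ?_
      gcongr
    have hmid : ∀ u, E ((1 / 2 : ℝ) • (v i + v j)) ≤ E u + ε := fun u => by
      have := cost_midpoint_le_average (g := g) hσ hr.le hN (v i) (v j)
      linarith [hnear i u, hnear j u]
    have := cost_midpoint_le (g := g) hσ hr.le hN hc (noiseLevel_mono hr.le (hU _ (hnear i)))
      (noiseLevel_mono hr.le (hU _ (hnear j))) (hL _ (hnear i)) (hL _ (hnear j)) (hL _ hmid)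
    change E _ ≤ (E _ + E _) / 2 - K * _ at this
    rw [dist_eq_norm]
    refine Real.le_sqrt_of_sq_le ?_
    rw [le_div_iff₀ hK0]
    linarith [hb i hi, hb j hj, hmle ((1 / 2 : ℝ) • (v i + v j))]
  have hlim : Filter.Tendsto (fun n : ℕ => ε / ((n : ℝ) + 1)) Filter.atTop (nhds 0) :=
    tendsto_const_div_atTop_nhds_zero_nat ε |>.comp (Filter.tendsto_add_atTop_nat 1) |>.congr
      (fun n => by simp)
  have hcau : CauchySeq v := by
    refine cauchySeq_of_le_tendsto_0' (fun n : ℕ => Real.sqrt (ε / (n + 1) / K))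
      (fun n k hnk => hdist n k n le_rfl hnk) ?_
    have := (hlim.div_const K).sqrt
    simpa using this
  obtain ⟨w, hw⟩ := cauchySeq_tendsto_of_complete hcau
  refine ⟨w, fun u => le_trans ?_ (hmle u)⟩
  have h1 := ((continuous_cost (σ := σ) (r := r) (g := g) hNc).tendsto w).comp hw
  have h2 : Filter.Tendsto (fun n : ℕ => m + ε / ((n : ℝ) + 1)) Filter.atTop (nhds m) := by
    simpa using hlim.const_add m
  exact le_of_tendsto_of_tendsto' h1 h2 (fun n => (hv n).le)

/-- A function `t a + t² b` that is nonnegative on `(0, 1]` has nonnegative slope at `0`. -/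
lemma nonneg_of_forall_le_quadratic {a b : ℝ}
    (h : ∀ t : ℝ, 0 < t → t ≤ 1 → 0 ≤ t * a + t ^ 2 * b) :
    0 ≤ a := by
  by_contra! ha
  have hb : 0 < b := by have := h 1 one_pos le_rfl; linarith
  set t := min 1 (-a / (2 * b)) with ht
  have ht0 : 0 < t := lt_min one_pos (div_pos (by linarith) (by linarith))
  have h1 := h t ht0 (min_le_left _ _)
  have h2 : t * (2 * b) ≤ -a := by
    rw [← le_div_iff₀ (by linarith)]; exact min_le_right _ _
  have h3 : 0 ≤ t * (a + t * b) := by linarith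
  have h4 : 0 ≤ a + t * b := nonneg_of_mul_nonneg_right h3 ht0
  linarith

/-- The tangent bound `√(τ² + x) ≤ τ + x/(2τ)`; this one-sided expansion replaces a derivative. -/
lemma noiseLevel_add_smul_le (hσ : 0 < σ ^ 2) (hr : 0 ≤ r) (v d : H) (t : ℝ) :
    noiseLevel σ r (v + t • d) ≤ noiseLevel σ r v +
      t * (r * inner ℝ v d / noiseLevel σ r v) + t ^ 2 * (r * ‖d‖ ^ 2 / (2 * noiseLevel σ r v)) := by
  have h0 := noiseLevel_pos hσ hr v
  set τ := noiseLevel σ r v with hτ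
  have hs : σ ^ 2 + r * ‖v + t • d‖ ^ 2 = τ ^ 2 + (2 * t * (r * inner ℝ v d) + t ^ 2 * (r * ‖d‖ ^ 2)) := by
    rw [hτ, noiseLevel_sq hr, norm_add_sq_real, norm_smul, inner_smul_right, mul_pow,
      Real.norm_eq_abs, sq_abs]; ring
  have hpos : 0 ≤ σ ^ 2 + r * ‖v + t • d‖ ^ 2 := by positivity
  set x := 2 * t * (r * inner ℝ v d) + t ^ 2 * (r * ‖d‖ ^ 2) with hx
  have e : τ + t * (r * inner ℝ v d / τ) + t ^ 2 * (r * ‖d‖ ^ 2 / (2 * τ)) = τ + x / (2 * τ) := by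
    rw [hx]; field_simp; ring
  rw [e, noiseLevel, hs]
  have h1 : τ + x / (2 * τ) = (τ ^ 2 + (τ ^ 2 + x)) / (2 * τ) := by field_simp; ring
  have h2 : 0 ≤ τ + x / (2 * τ) := by
    rw [h1]; rw [hs] at hpos; positivity
  rw [Real.sqrt_le_left h2]
  have h3 : x / (2 * τ) * τ * 2 = x := by field_simp
  nlinarith [sq_nonneg (x / (2 * τ))]

/-- The smooth part is differentiated along `u - v`, while convexity bounds the change of `N` by the
chord. The factor `gap / noiseLevel` plays the role of `ζ`. -/
lemma variational_inequality_of_isMin (hσ : 0 < σ ^ 2) (hr : 0 ≤ r) {N : H → ℝ}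
    (hN : ConvexOn ℝ Set.univ N) {v : H} (hv : ∀ u, cost σ r g N v ≤ cost σ r g N u)
    (hL : 0 < gap σ r g v) (u : H) :
    0 ≤ gap σ r g v / noiseLevel σ r v * r * inner ℝ (v - noiseLevel σ r v • g) (u - v)
      + (N u - N v) := by
  have h0 := noiseLevel_pos hσ hr v
  set τ := noiseLevel σ r v with hτ
  set L := gap σ r g v with hLdef
  set d := u - v with hd
  set l := r * inner ℝ v d / τ - r * inner ℝ g d with hl
  set k := r * ‖d‖ ^ 2 / (2 * τ) with hk
  have hk0 : 0 ≤ k := by positivity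
  have e : L / τ * r * inner ℝ (v - τ • g) d = L * l := by
    rw [inner_sub_left, real_inner_smul_left, hl]; field_simp
  rw [e]
  refine nonneg_of_forall_le_quadratic (b := L * k + (|l| + k) ^ 2 / 2) (fun t ht ht1 => ?_)
  have h1 := hv (v + t • d)
  have h2 : N (v + t • d) ≤ (1 - t) * N v + t * N u := by
    have := hN.2 (Set.mem_univ v) (Set.mem_univ u) (sub_nonneg.2 ht1) ht.le (by ring)
    have e2 : (1 - t) • v + t • u = v + t • d := by rw [hd, sub_smul, smul_sub, one_smul]; abel
    rwa [e2] at this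
  have h3 : gap σ r g (v + t • d) ≤ L + t * l + t ^ 2 * k := by
    have := noiseLevel_add_smul_le hσ hr v d t
    rw [← hτ] at this
    rw [hLdef, gap, gap, ← hτ, inner_add_right, inner_smul_right, hl]
    linarith
  have h4 : max (gap σ r g (v + t • d)) 0 ^ 2 ≤ (L + t * l + t ^ 2 * k) ^ 2 := by
    rcases le_total (gap σ r g (v + t • d)) 0 with h | h
    · rw [max_eq_right h]; nlinarith [sq_nonneg (L + t * l + t ^ 2 * k)]
    · rw [max_eq_left h]; gcongr
  unfold cost at h1
  rw [← hLdef, max_eq_left hL.le] at h1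
  have h5 : (t * l + t ^ 2 * k) ^ 2 ≤ t ^ 2 * (|l| + k) ^ 2 := by
    rw [show t * l + t ^ 2 * k = t * (l + t * k) by ring, mul_pow]
    gcongr ?_ * ?_
    rw [sq_le_sq, abs_of_nonneg (by positivity : 0 ≤ |l| + k)]
    refine (abs_add_le _ _).trans ?_
    rw [abs_mul, abs_of_pos ht, abs_of_nonneg hk0]
    nlinarith
  nlinarith

/-- With noise levels `a, b`, gaps `L, L'` and deficit `D = ab - P`, the two inequalities add up to
`0 ≤ -(L - L')² - LD/a - L'D/b`. Hence `D ≤ 0`, which forces `v = w`. The two noise levels may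
differ a priori. -/
lemma eq_of_variational_inequalities (hσ : 0 < σ ^ 2) (hr : 0 < r) {N : H → ℝ} {v w : H}
    (hv : 0 < gap σ r g v)
    (h1 : 0 ≤ gap σ r g v / noiseLevel σ r v * r * inner ℝ (v - noiseLevel σ r v • g) (w - v)
      + (N w - N v))
    (h2 : 0 ≤ gap σ r g w / noiseLevel σ r w * r * inner ℝ (w - noiseLevel σ r w • g) (v - w)
      + (N v - N w)) (hw : 0 < gap σ r g w) : v = w := by
  have hv0 := noiseLevel_pos hσ hr.le v
  have hw0 := noiseLevel_pos hσ hr.le w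
  have hcs := mul_inner_le_noiseLevel_mul (σ := σ) hr.le v w
  have hst := noiseLevel_mul_sub_ge (σ := σ) hr.le v w
  have ev := noiseLevel_sq (σ := σ) hr.le v
  have ew := noiseLevel_sq (σ := σ) hr.le w
  have gv : gap σ r g v = noiseLevel σ r v - r * inner ℝ g v := rfl
  have gw : gap σ r g w = noiseLevel σ r w - r * inner ℝ g w := rfl
  set a := noiseLevel σ r v
  set b := noiseLevel σ r w
  set P := σ ^ 2 + r * inner ℝ v w with hP
  have i1 : gap σ r g v / a * r * inner ℝ (v - a • g) (w - v) =
      gap σ r g v * (gap σ r g w - gap σ r g v) - gap σ r g v * ((a * b - P) / a) := by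
    rw [inner_sub_left, real_inner_smul_left, inner_sub_right, inner_sub_right,
      real_inner_self_eq_norm_sq]
    have : r * ‖v‖ ^ 2 = a ^ 2 - σ ^ 2 := by linarith
    field_simp
    rw [gw, gv]
    linear_combination -this - hP
  have i2 : gap σ r g w / b * r * inner ℝ (w - b • g) (v - w) =
      gap σ r g w * (gap σ r g v - gap σ r g w) - gap σ r g w * ((a * b - P) / b) := by
    rw [inner_sub_left, real_inner_smul_left, inner_sub_right, inner_sub_right,
      real_inner_self_eq_norm_sq, real_inner_comm v w]
    have : r * ‖w‖ ^ 2 = b ^ 2 - σ ^ 2 := by linarith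
    field_simp
    rw [gw, gv]
    linear_combination -this - hP
  have hx : 0 ≤ a * b - P := by linarith
  have h3 : 0 ≤ gap σ r g w * ((a * b - P) / b) := by positivity
  have h4 : gap σ r g v * ((a * b - P) / a) ≤ 0 := by
    nlinarith [sq_nonneg (gap σ r g v - gap σ r g w)]
  have h5 : (a * b - P) ≤ 0 := by
    have : (a * b - P) / a ≤ 0 := by
      by_contra! h; exact absurd h4 (not_le.2 (mul_pos hv h))
    by_contra! h; exact absurd this (not_le.2 (div_pos h hv0))
  have h6 : r * σ ^ 2 * ‖v - w‖ ^ 2 ≤ 0 := by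
    refine hst.trans ?_
    exact mul_nonpos_of_nonneg_of_nonpos (by positivity) h5
  have h7 : ‖v - w‖ ^ 2 ≤ 0 := by
    by_contra! h; exact absurd h6 (not_le.2 (by positivity))
  have h8 : ‖v - w‖ = 0 := by
    have := norm_nonneg (v - w); nlinarith
  exact sub_eq_zero.1 (norm_eq_zero.1 h8)

end HilbertSpace

/-! ### The square root of the covariance. -/

/-- `A` is a symmetric operator with inverse `B` such that `k ≤ A² ≤ K`. -/
structure IsSymmInversePair {p : ℕ} (A B : EuclideanSpace ℝ (Fin p) →L[ℝ] EuclideanSpace ℝ (Fin p))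
    (k K : ℝ) : Prop where
  apply_inv : ∀ x, A (B x) = x
  inv_apply : ∀ x, B (A x) = x
  symm : ∀ x y, inner ℝ (A x) y = inner ℝ x (A y)
  lower : ∀ x, k * ‖x‖ ^ 2 ≤ ‖A x‖ ^ 2
  upper : ∀ x, ‖A x‖ ^ 2 ≤ K * ‖x‖ ^ 2

lemma inner_act_self_eq_sum {p : ℕ} {C : Matrix (Fin p) (Fin p) ℝ} (hC : C.IsHermitian)
    (x : EuclideanSpace ℝ (Fin p)) :
    inner ℝ (act C x) x =
      ∑ j, hC.eigenvalues j * inner ℝ (hC.eigenvectorBasis j) x ^ 2 := by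
  have hsymm : ∀ u w : EuclideanSpace ℝ (Fin p), inner ℝ (act C u) w = inner ℝ u (act C w) :=
    fun u w => (Matrix.isSymmetric_toEuclideanLin_iff.2 hC) u w
  have hev : ∀ j, act C (hC.eigenvectorBasis j) = hC.eigenvalues j • hC.eigenvectorBasis j := by
    intro j
    ext i
    have := congrFun (hC.mulVec_eigenvectorBasis j) i
    simpa [act, Matrix.ofLp_toEuclideanCLM] using this
  rw [← hC.eigenvectorBasis.sum_inner_mul_inner]
  refine Finset.sum_congr rfl fun j _ => ?_
  rw [hsymm, hev, inner_smul_right, real_inner_comm]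
  ring

/-- `‖C^(1/2) x‖² = ⟨C x, x⟩` is diagonal in the eigenbasis of `C`, so the spectrum of the root
itself is not needed. -/
lemma isSymmInversePair_sqrt {p : ℕ} {C : Matrix (Fin p) (Fin p) ℝ} (hC : C.PosSemidef) {k K : ℝ}
    (hk : 0 < k)
    (h : ∀ j, k ≤ hC.isHermitian.eigenvalues j ∧ hC.isHermitian.eigenvalues j ≤ K) :
    IsSymmInversePair (act (CFC.sqrt C)) (act (CFC.sqrt C)⁻¹) k K := by
  have hS : (CFC.sqrt C).PosSemidef := Matrix.nonneg_iff_posSemidef.1 (CFC.sqrt_nonneg C)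
  have hsq : CFC.sqrt C * CFC.sqrt C = C := CFC.sqrt_mul_sqrt_self C hC.nonneg
  have hdet : IsUnit (CFC.sqrt C).det := by
    have h1 : C.det = ∏ i, hC.isHermitian.eigenvalues i := by
      simpa using hC.isHermitian.det_eq_prod_eigenvalues
    have h2 : 0 < C.det := by
      rw [h1]; exact Finset.prod_pos fun i _ => hk.trans_le (h i).1
    rw [isUnit_iff_ne_zero]
    intro h0
    rw [← hsq, Matrix.det_mul, h0] at h2
    simp at h2
  have hmul : ∀ (P Q : Matrix (Fin p) (Fin p) ℝ) (x : EuclideanSpace ℝ (Fin p)),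
      act P (act Q x) = act (P * Q) x := fun P Q x => by
    simp [act]
  have hsymm : ∀ u w : EuclideanSpace ℝ (Fin p),
      inner ℝ (act (CFC.sqrt C) u) w = inner ℝ u (act (CFC.sqrt C) w) :=
    fun u w => (Matrix.isSymmetric_toEuclideanLin_iff.2 hS.isHermitian) u w
  have hnorm : ∀ x : EuclideanSpace ℝ (Fin p), ‖act (CFC.sqrt C) x‖ ^ 2 =
      ∑ j, hC.isHermitian.eigenvalues j * inner ℝ (hC.isHermitian.eigenvectorBasis j) x ^ 2 := by
    intro x
    rw [← inner_act_self_eq_sum, ← real_inner_self_eq_norm_sq, hsymm, hmul, hsq, real_inner_comm]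
  have hpars : ∀ x : EuclideanSpace ℝ (Fin p), ‖x‖ ^ 2 =
      ∑ j, inner ℝ (hC.isHermitian.eigenvectorBasis j) x ^ 2 := fun x =>
    (OrthonormalBasis.sum_sq_inner_right _ x).symm
  refine ⟨fun x => ?_, fun x => ?_, hsymm, fun x => ?_, fun x => ?_⟩
  · rw [hmul, Matrix.mul_nonsing_inv _ hdet]; simp [act]
  · rw [hmul, Matrix.nonsing_inv_mul _ hdet]; simp [act]
  · rw [hnorm, hpars, Finset.mul_sum]
    gcongr with j _
    exact (h j).1
  · rw [hnorm, hpars, Finset.mul_sum]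
    gcongr with j _
    exact (h j).2

namespace IsSymmInversePair

variable {p : ℕ} {A B : EuclideanSpace ℝ (Fin p) →L[ℝ] EuclideanSpace ℝ (Fin p)} {k K : ℝ}

lemma inner_inv_apply (h : IsSymmInversePair A B k K) (v g : EuclideanSpace ℝ (Fin p)) :
    inner ℝ (B v) (A g) = inner ℝ v g := by
  rw [← h.symm, h.apply_inv]

lemma inv_upper (h : IsSymmInversePair A B k K) (hk : 0 < k) (v : EuclideanSpace ℝ (Fin p)) :
    ‖B v‖ ^ 2 ≤ k⁻¹ * ‖v‖ ^ 2 := by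
  have := h.lower (B v)
  rw [h.apply_inv] at this
  rw [inv_mul_eq_div, le_div_iff₀ hk]; linarith

end IsSymmInversePair

/-! ### Gaussian moments. -/

section Gaussian

variable {p : ℕ}

lemma memLp_id_gaussian : MemLp (fun g : EuclideanSpace ℝ (Fin p) => g) 2 (gaussian p) :=
  IsGaussian.memLp_two_id

lemma integral_inner_gaussian (a : EuclideanSpace ℝ (Fin p)) :
    ∫ g, inner ℝ a g ∂(gaussian p) = 0 :=
  integral_strongDual_stdGaussian (innerSL ℝ a)

lemma integral_inner_sq_gaussian (a : EuclideanSpace ℝ (Fin p)) :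
    ∫ g, inner ℝ a g ^ 2 ∂(gaussian p) = ‖a‖ ^ 2 := by
  have h := variance_dual_stdGaussian (innerSL ℝ a)
  rw [variance_eq_sub, integral_strongDual_stdGaussian, innerSL_apply_norm] at h
  · simpa using h
  · exact memLp_id_gaussian.const_inner a

lemma integral_norm_sq_gaussian : ∫ g, ‖g‖ ^ 2 ∂(gaussian p) = p := by
  have h : ∀ g : EuclideanSpace ℝ (Fin p), ‖g‖ ^ 2 =
      ∑ j, inner ℝ (EuclideanSpace.basisFun (Fin p) ℝ j) g ^ 2 := fun g =>
    (OrthonormalBasis.sum_sq_inner_right _ g).symm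
  simp_rw [h]
  rw [integral_finsetSum]
  · simp_rw [integral_inner_sq_gaussian]; simp
  · exact fun j _ => (memLp_id_gaussian.const_inner _).integrable_sq

lemma integrable_inner_pow_four_gaussian (a : EuclideanSpace ℝ (Fin p)) :
    Integrable (fun g => inner ℝ a g ^ 4) (gaussian p) := by
  have h : MemLp (fun g : EuclideanSpace ℝ (Fin p) => g) 4 (gaussian p) :=
    IsGaussian.memLp_id _ 4 (by norm_num)
  have h' : MemLp (fun g : EuclideanSpace ℝ (Fin p) => inner ℝ a g) ((4 : ℕ) : ENNReal)
      (gaussian p) := by exact_mod_cast h.const_inner (𝕜 := ℝ) a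
  have := h'.integrable_norm_pow (by norm_num)
  refine this.congr (Filter.Eventually.of_forall fun g => ?_)
  simp only [Real.norm_eq_abs]
  exact Even.pow_abs (by decide) _

lemma pow_four_le_exp (x : ℝ) : x ^ 4 ≤ 24 * (Real.exp x + Real.exp (-x)) := by
  have h : ∀ y : ℝ, 0 ≤ y → y ^ 4 ≤ 24 * Real.exp y := fun y hy => by
    have := Real.pow_div_factorial_le_exp y hy 4
    norm_num [Nat.factorial] at this
    linarith
  rcases le_total 0 x with hx | hx
  · linarith [h x hx, Real.exp_pos (-x)]
  · have := h (-x) (by linarith)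
    have e : (-x) ^ 4 = x ^ 4 := by ring
    linarith [Real.exp_pos x]

/-- A crude bound through the exponential moments at `±1`; only its dependence on `‖a‖` alone
matters. -/
lemma integral_inner_pow_four_gaussian_le (a : EuclideanSpace ℝ (Fin p)) :
    ∫ g, inner ℝ a g ^ 4 ∂(gaussian p) ≤ 48 * Real.exp (‖a‖ ^ 2 / 2) := by
  have hmap : (gaussian p).map (innerSL ℝ a) = gaussianReal 0 (‖a‖ ^ 2).toNNReal := by
    rw [IsGaussian.map_eq_gaussianReal (innerSL ℝ a), integral_strongDual_stdGaussian,
      variance_dual_stdGaussian, innerSL_apply_norm]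
  have hexp : ∀ t : ℝ, ∫ g, Real.exp (t * inner ℝ a g) ∂(gaussian p) =
      Real.exp (‖a‖ ^ 2 * t ^ 2 / 2) := fun t => by
    have := mgf_gaussianReal hmap t
    simpa [mgf, Real.coe_toNNReal _ (sq_nonneg ‖a‖)] using this
  have hint : ∀ t : ℝ, Integrable (fun g => Real.exp (t * inner ℝ a g)) (gaussian p) := fun t => by
    -- A non-integrable function would have integral `0`, but the value is a positive exponential.
    by_contra h
    have := hexp t
    rw [integral_undef h] at this
    exact absurd this (Real.exp_pos _).ne
  have h1 := hint 1
  have h2 := hint (-1)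
  have e1 := hexp 1
  have e2 := hexp (-1)
  simp only [one_mul, neg_one_mul] at h1 h2 e1 e2
  calc ∫ g, inner ℝ a g ^ 4 ∂(gaussian p)
      ≤ ∫ g, 24 * (Real.exp (inner ℝ a g) + Real.exp (-inner ℝ a g)) ∂(gaussian p) :=
        integral_mono (integrable_inner_pow_four_gaussian a) ((h1.add h2).const_mul 24)
          fun g => pow_four_le_exp _
    _ = 48 * Real.exp (‖a‖ ^ 2 / 2) := by
        rw [integral_const_mul, integral_add h1 h2, e1, e2]
        norm_num; ring

end Gaussian

/-! ### The `ℓ₁` norm. -/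

section LOneNorm

variable {p : ℕ}

lemma l1Norm_nonneg (θ : EuclideanSpace ℝ (Fin p)) : 0 ≤ l1Norm θ :=
  Finset.sum_nonneg fun _ _ => abs_nonneg _

lemma l1Norm_add_le (a b : EuclideanSpace ℝ (Fin p)) : l1Norm (a + b) ≤ l1Norm a + l1Norm b := by
  unfold l1Norm
  rw [← Finset.sum_add_distrib]
  exact Finset.sum_le_sum fun j _ => abs_add_le _ _

lemma l1Norm_smul (t : ℝ) (a : EuclideanSpace ℝ (Fin p)) : l1Norm (t • a) = |t| * l1Norm a := by
  unfold l1Norm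
  rw [Finset.mul_sum]
  exact Finset.sum_congr rfl fun j _ => by simp [abs_mul]

lemma norm_le_l1Norm (θ : EuclideanSpace ℝ (Fin p)) : ‖θ‖ ≤ l1Norm θ := by
  refine abs_le_of_sq_le_sq' ?_ (l1Norm_nonneg θ) |>.2
  rw [EuclideanSpace.real_norm_sq_eq]
  have : ∀ j, θ j ^ 2 = |θ j| ^ 2 := fun j => (sq_abs _).symm
  simp_rw [this]
  exact Finset.sum_sq_le_sq_sum_of_nonneg fun j _ => abs_nonneg _

lemma l1Norm_sq_le (θ : EuclideanSpace ℝ (Fin p)) : l1Norm θ ^ 2 ≤ p * ‖θ‖ ^ 2 := by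
  rw [EuclideanSpace.real_norm_sq_eq]
  have := sq_sum_le_card_mul_sum_sq (s := Finset.univ) (f := fun j => |θ j|)
  simpa [l1Norm] using this

lemma l1Norm_le (θ : EuclideanSpace ℝ (Fin p)) : l1Norm θ ≤ Real.sqrt p * ‖θ‖ := by
  refine abs_le_of_sq_le_sq' ?_ (by positivity) |>.2
  rw [mul_pow, Real.sq_sqrt (by positivity)]
  exact l1Norm_sq_le θ

lemma continuous_l1Norm : Continuous (l1Norm (p := p)) := by
  unfold l1Norm; fun_prop

lemma convexOn_l1Norm : ConvexOn ℝ Set.univ (l1Norm (p := p)) := by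
  refine ⟨convex_univ, fun a _ b _ s t hs ht _ => ?_⟩
  refine (l1Norm_add_le _ _).trans ?_
  rw [l1Norm_smul, l1Norm_smul, abs_of_nonneg hs, abs_of_nonneg ht]
  rfl

end LOneNorm

/-! ### The Lasso estimator and its prediction error. -/

section Estimator

variable {p : ℕ} {Cov : Matrix (Fin p) (Fin p) ℝ} {lam : ℝ}

/-- The penalty alone makes the objective coercive, so `ζ = 0` is allowed. -/
lemma lassoEstimator_isMin (hlam : 0 < lam) (y : EuclideanSpace ℝ (Fin p)) {ζ : ℝ} (hζ : 0 ≤ ζ)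
    (θ : EuclideanSpace ℝ (Fin p)) :
    lassoObjective Cov lam y ζ (lassoEstimator Cov lam y ζ) ≤ lassoObjective Cov lam y ζ θ := by
  have hex : ∃ θ, ∀ θ', lassoObjective Cov lam y ζ θ ≤ lassoObjective Cov lam y ζ θ' := by
    have hcont : Continuous (lassoObjective Cov lam y ζ) := by
      have := continuous_l1Norm (p := p)
      unfold lassoObjective
      fun_prop
    refine hcont.exists_forall_le ?_
    refine Filter.tendsto_atTop_mono (fun θ => ?_)
      ((tendsto_norm_cocompact_atTop (E := EuclideanSpace ℝ (Fin p))).const_mul_atTop hlam)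
    have h1 : lam * ‖θ‖ ≤ lam * l1Norm θ := by gcongr; exact norm_le_l1Norm θ
    have h2 : 0 ≤ ζ / 2 * ‖y - act (CFC.sqrt Cov) θ‖ ^ 2 := by positivity
    unfold lassoObjective
    linarith
  rw [lassoEstimator, dif_pos hex]
  exact hex.choose_spec θ

lemma lassoEstimator_zero (hlam : 0 < lam) (y : EuclideanSpace ℝ (Fin p)) :
    lassoEstimator Cov lam y 0 = 0 := by
  have h := lassoEstimator_isMin (Cov := Cov) hlam y le_rfl 0
  have h0 : l1Norm (0 : EuclideanSpace ℝ (Fin p)) = 0 := by simp [l1Norm]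
  simp only [lassoObjective, zero_div, zero_mul, zero_add, h0, mul_zero] at h
  have h1 : l1Norm (lassoEstimator Cov lam y 0) ≤ 0 := by
    by_contra! hc; exact absurd h (not_le.2 (mul_pos hlam hc))
  exact norm_le_zero_iff.1 ((norm_le_l1Norm _).trans h1)

lemma lassoEstimator_variational_inequality (hlam : 0 < lam) (y : EuclideanSpace ℝ (Fin p)) {ζ : ℝ}
    (hζ : 0 ≤ ζ) (θ : EuclideanSpace ℝ (Fin p)) :
    0 ≤ ζ * inner ℝ (prediction Cov lam y ζ - y)
        (act (CFC.sqrt Cov) θ - prediction Cov lam y ζ)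
      + lam * (l1Norm θ - l1Norm (lassoEstimator Cov lam y ζ)) := by
  unfold prediction
  set η := lassoEstimator Cov lam y ζ with hη
  set A := act (CFC.sqrt Cov) with hA
  refine nonneg_of_forall_le_quadratic (b := ζ / 2 * ‖A θ - A η‖ ^ 2) (fun t ht ht1 => ?_)
  have h1 := lassoEstimator_isMin (Cov := Cov) hlam y hζ (η + t • (θ - η))
  have h2 : l1Norm (η + t • (θ - η)) ≤ (1 - t) * l1Norm η + t * l1Norm θ := by
    have := convexOn_l1Norm.2 (Set.mem_univ η) (Set.mem_univ θ) (sub_nonneg.2 ht1) ht.le (by ring)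
    have e2 : (1 - t) • η + t • θ = η + t • (θ - η) := by
      rw [sub_smul, smul_sub, one_smul]; abel
    rwa [e2] at this
  have e : y - A (η + t • (θ - η)) = (y - A η) - t • (A θ - A η) := by
    rw [map_add, map_smul, map_sub]; abel
  unfold lassoObjective at h1
  rw [← hη, ← hA, e, norm_sub_sq_real (y - A η), inner_smul_right, norm_smul, mul_pow,
    Real.norm_eq_abs, sq_abs] at h1
  have e3 : inner ℝ (A η - y) (A θ - A η) = - inner ℝ (y - A η) (A θ - A η) := by
    rw [← inner_neg_left, neg_sub]
  rw [e3]
  have h3 := mul_le_mul_of_nonneg_left h2 hlam.le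
  nlinarith

/-- Testing each variational inequality with the other estimate gives `‖a - b‖² ≤ ⟨y - z, a - b⟩`.
The resulting continuity supplies measurability of an estimator that is defined by choice. -/
lemma norm_prediction_sub_le (hlam : 0 < lam) {ζ : ℝ} (hζ : 0 < ζ)
    (y z : EuclideanSpace ℝ (Fin p)) :
    ‖prediction Cov lam y ζ - prediction Cov lam z ζ‖ ≤ ‖y - z‖ := by
  have h1 := lassoEstimator_variational_inequality (Cov := Cov) hlam y hζ.le
    (lassoEstimator Cov lam z ζ)
  have h2 := lassoEstimator_variational_inequality (Cov := Cov) hlam z hζ.le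
    (lassoEstimator Cov lam y ζ)
  have e1 : act (CFC.sqrt Cov) (lassoEstimator Cov lam z ζ) = prediction Cov lam z ζ := rfl
  have e2 : act (CFC.sqrt Cov) (lassoEstimator Cov lam y ζ) = prediction Cov lam y ζ := rfl
  rw [e1] at h1
  rw [e2] at h2
  set a := prediction Cov lam y ζ
  set b := prediction Cov lam z ζ
  have e3 : inner ℝ (a - y) (b - a) + inner ℝ (b - z) (a - b) =
      inner ℝ (y - z) (a - b) - ‖a - b‖ ^ 2 := by
    rw [← real_inner_self_eq_norm_sq, ← neg_sub a b, inner_neg_right]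
    simp only [inner_sub_left]; ring
  have h3 : 0 ≤ ζ * (inner ℝ (y - z) (a - b) - ‖a - b‖ ^ 2) := by rw [← e3]; linarith
  have h4 := nonneg_of_mul_nonneg_right h3 hζ
  have h5 := real_inner_le_norm (y - z) (a - b)
  by_contra! hc
  nlinarith [norm_nonneg (y - z), norm_nonneg (a - b)]

lemma continuous_prediction (hlam : 0 < lam) {ζ : ℝ} (hζ : 0 < ζ) :
    Continuous fun y => prediction Cov lam y ζ :=
  (LipschitzWith.of_dist_le_mul (K := 1) fun y z => by
    simpa [dist_eq_norm] using norm_prediction_sub_le (Cov := Cov) hlam hζ y z).continuous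

/-- The estimation error `ŷ(Cov ^ (1/2) θ + τ g, ζ) - Cov ^ (1/2) θ` as a function of the noise. -/
noncomputable def predictionError (Cov : Matrix (Fin p) (Fin p) ℝ) (lam : ℝ)
    (θ : EuclideanSpace ℝ (Fin p)) (τ ζ : ℝ) (g : EuclideanSpace ℝ (Fin p)) :
    EuclideanSpace ℝ (Fin p) :=
  prediction Cov lam (act (CFC.sqrt Cov) θ + τ • g) ζ - act (CFC.sqrt Cov) θ

/-- The `ℓ₁` penalty as a function of the prediction error. -/
noncomputable def penalty (Cov : Matrix (Fin p) (Fin p) ℝ) (θ v : EuclideanSpace ℝ (Fin p)) : ℝ :=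
  l1Norm (θ + act (CFC.sqrt Cov)⁻¹ v)

variable {k K : ℝ} {θ : EuclideanSpace ℝ (Fin p)}

/-- Optimality of the Lasso in the coordinate `u = Σ^(1/2)(θ' - θ)`, where the data are just `τ g`.
-/
lemma predictionError_variational_inequality
    (h : IsSymmInversePair (act (CFC.sqrt Cov)) (act (CFC.sqrt Cov)⁻¹) k K)
    (hlam : 0 < lam) {τ ζ : ℝ} (hζ : 0 ≤ ζ) (g u : EuclideanSpace ℝ (Fin p)) :
    0 ≤ ζ * inner ℝ (predictionError Cov lam θ τ ζ g - τ • g) (u - predictionError Cov lam θ τ ζ g)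
      + lam * (penalty Cov θ u - penalty Cov θ (predictionError Cov lam θ τ ζ g)) := by
  have h1 := lassoEstimator_variational_inequality (Cov := Cov) hlam
    (act (CFC.sqrt Cov) θ + τ • g) hζ (θ + act (CFC.sqrt Cov)⁻¹ u)
  have e1 : penalty Cov θ (predictionError Cov lam θ τ ζ g) =
      l1Norm (lassoEstimator Cov lam (act (CFC.sqrt Cov) θ + τ • g) ζ) := by
    unfold penalty predictionError prediction
    rw [← map_sub, h.inv_apply]
    congr 1; abel
  rw [map_add, h.apply_inv] at h1
  rw [e1]
  unfold penalty predictionError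
  convert h1 using 4 <;> abel

lemma memLp_predictionError (hlam : 0 < lam) {τ ζ : ℝ} (hζ : 0 < ζ) :
    MemLp (predictionError Cov lam θ τ ζ) 2 (gaussian p) := by
  have hc : Continuous (predictionError Cov lam θ τ ζ) := by
    have := continuous_prediction (Cov := Cov) hlam hζ
    unfold predictionError
    fun_prop
  have h1 : MemLp (fun g : EuclideanSpace ℝ (Fin p) =>
      ‖predictionError Cov lam θ τ ζ 0‖ + ‖τ • g‖) 2 (gaussian p) :=
    (memLp_const ‖predictionError Cov lam θ τ ζ 0‖).add
      (MemLp.norm (f := fun g : EuclideanSpace ℝ (Fin p) => τ • g) (memLp_id_gaussian.const_smul τ))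
  refine h1.mono hc.aestronglyMeasurable (Filter.Eventually.of_forall fun g => ?_)
  rw [Real.norm_of_nonneg (by positivity)]
  have h2 := norm_prediction_sub_le (Cov := Cov) hlam hζ (act (CFC.sqrt Cov) θ + τ • g)
    (act (CFC.sqrt Cov) θ + τ • 0)
  have e : predictionError Cov lam θ τ ζ g = predictionError Cov lam θ τ ζ 0 +
      (prediction Cov lam (act (CFC.sqrt Cov) θ + τ • g) ζ -
        prediction Cov lam (act (CFC.sqrt Cov) θ + τ • 0) ζ) := by
    unfold predictionError; abel
  rw [e]
  refine (norm_add_le _ _).trans ?_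
  gcongr
  simpa using h2

end Estimator

/-! ### The L² space of error functions. -/

section ErrorSpace

variable {p : ℕ}

/-- The Hilbert space of square-integrable functions of the noise. -/
noncomputable abbrev ErrorSpace (p : ℕ) : Type := Lp (EuclideanSpace ℝ (Fin p)) 2 (gaussian p)

/-- The Gaussian noise as an element of the Hilbert space. -/
noncomputable def noise (p : ℕ) : ErrorSpace p := memLp_id_gaussian.toLp (fun g => g)

variable {f h : EuclideanSpace ℝ (Fin p) → EuclideanSpace ℝ (Fin p)}

lemma inner_toLp_toLp (hf : MemLp f 2 (gaussian p)) (hh : MemLp h 2 (gaussian p)) :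
    inner ℝ (hf.toLp f) (hh.toLp h) = ∫ g, inner ℝ (f g) (h g) ∂(gaussian p) := by
  rw [MeasureTheory.L2.inner_def]
  refine integral_congr_ae ?_
  filter_upwards [hf.coeFn_toLp, hh.coeFn_toLp] with g h1 h2
  rw [h1, h2]

lemma norm_toLp_sq (hf : MemLp f 2 (gaussian p)) :
    ‖hf.toLp f‖ ^ 2 = ∫ g, ‖f g‖ ^ 2 ∂(gaussian p) := by
  rw [← real_inner_self_eq_norm_sq, inner_toLp_toLp hf hf]
  simp_rw [real_inner_self_eq_norm_sq]

lemma inner_noise_toLp (hf : MemLp f 2 (gaussian p)) :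
    inner ℝ (noise p) (hf.toLp f) = ∫ g, inner ℝ (f g) g ∂(gaussian p) := by
  rw [real_inner_comm]
  exact inner_toLp_toLp hf memLp_id_gaussian

lemma norm_noise_sq : ‖noise p‖ ^ 2 = p := by
  rw [noise, norm_toLp_sq, integral_norm_sq_gaussian]

lemma integrable_inner_of_memLp (hf : MemLp f 2 (gaussian p)) (hh : MemLp h 2 (gaussian p)) :
    Integrable (fun g => inner ℝ (f g) (h g)) (gaussian p) := by
  refine (L2.integrable_inner (𝕜 := ℝ) (hf.toLp f) (hh.toLp h)).congr ?_
  filter_upwards [hf.coeFn_toLp, hh.coeFn_toLp] with g h1 h2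
  rw [h1, h2]

lemma sq_integral_le {X : EuclideanSpace ℝ (Fin p) → ℝ} (hX : MemLp X 2 (gaussian p)) :
    (∫ g, X g ∂(gaussian p)) ^ 2 ≤ ∫ g, X g ^ 2 ∂(gaussian p) := by
  have h1 := variance_nonneg X (gaussian p)
  rw [variance_eq_sub hX] at h1
  have h2 : ∫ g, X g ^ 2 ∂(gaussian p) = (gaussian p)[X ^ 2] := rfl
  rw [h2]; linarith

lemma integral_norm_le_norm_toLp (hf : MemLp f 2 (gaussian p)) :
    ∫ g, ‖f g‖ ∂(gaussian p) ≤ ‖hf.toLp f‖ := by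
  refine abs_le_of_sq_le_sq' ?_ (norm_nonneg _) |>.2
  rw [norm_toLp_sq]
  exact sq_integral_le hf.norm

lemma integrable_l1Norm (hf : MemLp f 2 (gaussian p)) :
    Integrable (fun g => l1Norm (f g)) (gaussian p) := by
  refine ((hf.integrable (by norm_num)).norm.const_mul (Real.sqrt p)).mono'
    (continuous_l1Norm.comp_aestronglyMeasurable hf.1) (Filter.Eventually.of_forall fun g => ?_)
  rw [Real.norm_of_nonneg (l1Norm_nonneg _)]
  exact l1Norm_le _

lemma integral_l1Norm_le (hf : MemLp f 2 (gaussian p)) :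
    ∫ g, l1Norm (f g) ∂(gaussian p) ≤ Real.sqrt p * ‖hf.toLp f‖ := by
  calc ∫ g, l1Norm (f g) ∂(gaussian p) ≤ ∫ g, Real.sqrt p * ‖f g‖ ∂(gaussian p) :=
        integral_mono (integrable_l1Norm hf) ((hf.integrable (by norm_num)).norm.const_mul _)
          fun g => l1Norm_le _
    _ ≤ _ := by
        rw [integral_const_mul]; gcongr; exact integral_norm_le_norm_toLp hf

lemma memLp_clm_comp (B : EuclideanSpace ℝ (Fin p) →L[ℝ] EuclideanSpace ℝ (Fin p))
    (hf : MemLp f 2 (gaussian p)) : MemLp (fun g => B (f g)) 2 (gaussian p) :=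
  B.comp_memLp' hf

end ErrorSpace

/-! ### The mean penalty is convex and Lipschitz on L². -/

section MeanPenalty

variable {p : ℕ} {Cov : Matrix (Fin p) (Fin p) ℝ} {θ : EuclideanSpace ℝ (Fin p)}
  {f : EuclideanSpace ℝ (Fin p) → EuclideanSpace ℝ (Fin p)}

/-- The expected penalty as a functional of the prediction error. -/
noncomputable def meanPenalty (Cov : Matrix (Fin p) (Fin p) ℝ) (θ : EuclideanSpace ℝ (Fin p))
    (r lam : ℝ) (v : ErrorSpace p) : ℝ :=
  r * lam * ∫ g, penalty Cov θ (v g) ∂(gaussian p)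

lemma memLp_penalty_arg (hf : MemLp f 2 (gaussian p)) :
    MemLp (fun g => θ + act (CFC.sqrt Cov)⁻¹ (f g)) 2 (gaussian p) :=
  (memLp_const θ).add (memLp_clm_comp _ hf)

lemma integrable_penalty (hf : MemLp f 2 (gaussian p)) :
    Integrable (fun g => penalty Cov θ (f g)) (gaussian p) :=
  integrable_l1Norm (memLp_penalty_arg hf)

lemma meanPenalty_toLp {r lam : ℝ} (hf : MemLp f 2 (gaussian p)) :
    meanPenalty Cov θ r lam (hf.toLp f) = r * lam * ∫ g, penalty Cov θ (f g) ∂(gaussian p) := by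
  unfold meanPenalty
  congr 1
  refine integral_congr_ae ?_
  filter_upwards [hf.coeFn_toLp] with g h1
  rw [h1]

variable {r lam : ℝ}

lemma meanPenalty_nonneg (hr : 0 ≤ r) (hlam : 0 ≤ lam) (v : ErrorSpace p) :
    0 ≤ meanPenalty Cov θ r lam v :=
  mul_nonneg (mul_nonneg hr hlam) (integral_nonneg fun _ => l1Norm_nonneg _)

lemma penalty_combo_le {s t : ℝ} (hs : 0 ≤ s) (ht : 0 ≤ t) (hst : s + t = 1)
    (u v : EuclideanSpace ℝ (Fin p)) :
    penalty Cov θ (s • u + t • v) ≤ s * penalty Cov θ u + t * penalty Cov θ v := by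
  unfold penalty
  have e : θ + act (CFC.sqrt Cov)⁻¹ (s • u + t • v) =
      s • (θ + act (CFC.sqrt Cov)⁻¹ u) + t • (θ + act (CFC.sqrt Cov)⁻¹ v) := by
    rw [map_add, map_smul, map_smul, smul_add, smul_add]
    nth_rw 1 [← one_smul ℝ θ, ← hst, add_smul]
    abel
  rw [e]
  exact convexOn_l1Norm.2 (Set.mem_univ _) (Set.mem_univ _) hs ht hst

lemma convexOn_meanPenalty (hr : 0 ≤ r) (hlam : 0 ≤ lam) :
    ConvexOn ℝ Set.univ (meanPenalty Cov θ r lam) := by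
  refine ⟨convex_univ, fun u _ v _ s t hs ht hst => ?_⟩
  have hu := integrable_penalty (Cov := Cov) (θ := θ) (Lp.memLp u)
  have hv := integrable_penalty (Cov := Cov) (θ := θ) (Lp.memLp v)
  have h1 : ∫ g, penalty Cov θ ((s • u + t • v : ErrorSpace p) g) ∂(gaussian p) ≤
      s * ∫ g, penalty Cov θ (u g) ∂(gaussian p) + t * ∫ g, penalty Cov θ (v g) ∂(gaussian p) := by
    rw [← integral_const_mul, ← integral_const_mul,
      ← integral_add (hu.const_mul s) (hv.const_mul t)]
    refine integral_mono_ae (integrable_penalty (Lp.memLp _))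
      ((hu.const_mul s).add (hv.const_mul t)) ?_
    filter_upwards [Lp.coeFn_add (s • u) (t • v), Lp.coeFn_smul s u, Lp.coeFn_smul t v]
      with g e1 e2 e3
    rw [e1, Pi.add_apply, e2, e3]
    exact penalty_combo_le hs ht hst _ _
  unfold meanPenalty
  simp only [smul_eq_mul]
  calc _ ≤ r * lam * (s * ∫ g, penalty Cov θ (u g) ∂(gaussian p) +
        t * ∫ g, penalty Cov θ (v g) ∂(gaussian p)) := by gcongr
    _ = _ := by ring

lemma meanPenalty_sub_le (hr : 0 ≤ r) (hlam : 0 ≤ lam) (u v : ErrorSpace p) :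
    meanPenalty Cov θ r lam u - meanPenalty Cov θ r lam v ≤
      r * lam * (Real.sqrt p * (‖act (CFC.sqrt Cov)⁻¹‖ * ‖u - v‖)) := by
  have hu := integrable_penalty (Cov := Cov) (θ := θ) (Lp.memLp u)
  have hv := integrable_penalty (Cov := Cov) (θ := θ) (Lp.memLp v)
  unfold meanPenalty
  rw [← mul_sub, ← integral_sub hu hv]
  gcongr
  have hd : MemLp (fun g => (u - v : ErrorSpace p) g) 2 (gaussian p) := Lp.memLp _
  have hn : ∫ g, ‖(u - v : ErrorSpace p) g‖ ∂(gaussian p) ≤ ‖u - v‖ := by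
    have := integral_norm_le_norm_toLp hd
    rwa [Lp.toLp_coeFn] at this
  calc ∫ g, (penalty Cov θ (u g) - penalty Cov θ (v g)) ∂(gaussian p)
      ≤ ∫ g, Real.sqrt p * (‖act (CFC.sqrt Cov)⁻¹‖ * ‖(u - v : ErrorSpace p) g‖) ∂(gaussian p) := by
        refine integral_mono_ae (hu.sub hv)
          (((hd.integrable (by norm_num)).norm.const_mul _).const_mul _) ?_
        filter_upwards [Lp.coeFn_sub u v] with g e
        rw [e, Pi.sub_apply]
        have h1 : penalty Cov θ (u g) ≤ penalty Cov θ (v g) +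
            l1Norm (act (CFC.sqrt Cov)⁻¹ (u g - v g)) := by
          unfold penalty
          refine le_trans (le_of_eq ?_) (l1Norm_add_le _ _)
          rw [map_sub]; congr 1; abel
        have h2 := l1Norm_le (act (CFC.sqrt Cov)⁻¹ (u g - v g))
        have h3 := mul_le_mul_of_nonneg_left ((act (CFC.sqrt Cov)⁻¹).le_opNorm (u g - v g))
          (Real.sqrt_nonneg p)
        linarith
    _ ≤ _ := by
        rw [integral_const_mul, integral_const_mul]; gcongr

lemma continuous_meanPenalty (hr : 0 ≤ r) (hlam : 0 ≤ lam) :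
    Continuous (meanPenalty Cov θ r lam) := by
  set C := r * lam * (Real.sqrt p * ‖act (CFC.sqrt Cov)⁻¹‖) with hC
  have hC0 : 0 ≤ C := by positivity
  refine (LipschitzWith.of_le_add_mul (⟨C, hC0⟩ : NNReal) fun u v => ?_).continuous
  have := meanPenalty_sub_le (Cov := Cov) (θ := θ) hr hlam u v
  rw [dist_eq_norm]
  change _ ≤ _ + C * _
  rw [hC]; linarith

end MeanPenalty

/-! ### Fixed points and minimizers. -/

section FixedPoint

variable {p n : ℕ} {Cov : Matrix (Fin p) (Fin p) ℝ} {θ : EuclideanSpace ℝ (Fin p)} {k K lam σ τ ζ : ℝ}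

/-- At `ζ = 0` the estimator vanishes, so the second equation would read `0 = 1`. -/
lemma IsFixedPoint.zeta_pos (h : IsFixedPoint n Cov σ lam θ τ ζ) (hlam : 0 < lam) : 0 < ζ := by
  obtain ⟨_, h2, _, h4⟩ := h
  refine lt_of_le_of_ne h2 fun h0 => ?_
  rw [← h0] at h4
  simp [degreesOfFreedom, prediction, lassoEstimator_zero hlam] at h4

lemma risk_eq (hf : MemLp (predictionError Cov lam θ τ ζ) 2 (gaussian p)) :
    risk n Cov lam θ τ ζ = 1 / (n : ℝ) * ‖hf.toLp _‖ ^ 2 := by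
  rw [norm_toLp_sq]; rfl

lemma degreesOfFreedom_eq (hf : MemLp (predictionError Cov lam θ τ ζ) 2 (gaussian p)) :
    degreesOfFreedom n Cov lam θ τ ζ =
      1 / ((n : ℝ) * τ) * inner ℝ (noise p) (hf.toLp _) := by
  rw [inner_noise_toLp, degreesOfFreedom]
  congr 1
  have h1 : ∀ g, inner ℝ (prediction Cov lam (act (CFC.sqrt Cov) θ + τ • g) ζ) g =
      inner ℝ (predictionError Cov lam θ τ ζ g) g + inner ℝ (act (CFC.sqrt Cov) θ) g := fun g => by
    rw [← inner_add_left, predictionError, sub_add_cancel]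
  simp_rw [h1]
  rw [integral_add (integrable_inner_of_memLp hf memLp_id_gaussian)
    (integrable_inner_of_memLp (memLp_const _) memLp_id_gaussian), integral_inner_gaussian, add_zero]

/-- The pointwise inequality integrated over the noise; it then has the form of the first-order
condition of the cost. -/
lemma toLp_predictionError_variational_inequality
    (h : IsSymmInversePair (act (CFC.sqrt Cov)) (act (CFC.sqrt Cov)⁻¹) k K)
    (hlam : 0 < lam) (hζ : 0 ≤ ζ) (hf : MemLp (predictionError Cov lam θ τ ζ) 2 (gaussian p))
    {r : ℝ} (hr : 0 ≤ r) (u : ErrorSpace p) :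
    0 ≤ ζ * r * inner ℝ (hf.toLp _ - τ • noise p) (u - hf.toLp _)
      + (meanPenalty Cov θ r lam u - meanPenalty Cov θ r lam (hf.toLp _)) := by
  have hu := Lp.memLp u
  have hg := (memLp_id_gaussian (p := p)).const_smul τ
  have e1 : hf.toLp _ - τ • noise p =
      (hf.sub hg).toLp (fun g => predictionError Cov lam θ τ ζ g - τ • g) := rfl
  have e2 : u - hf.toLp _ = (hu.sub hf).toLp (fun g => u g - predictionError Cov lam θ τ ζ g) := by
    nth_rw 1 [← Lp.toLp_coeFn u hu]; rfl
  have e3 : meanPenalty Cov θ r lam u = r * lam * ∫ g, penalty Cov θ (u g) ∂(gaussian p) := rfl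
  rw [e1, e2, inner_toLp_toLp, meanPenalty_toLp, e3]
  have i1 : Integrable (fun g => inner ℝ (predictionError Cov lam θ τ ζ g - τ • g)
      (u g - predictionError Cov lam θ τ ζ g)) (gaussian p) :=
    integrable_inner_of_memLp (hf.sub hg) (hu.sub hf)
  have i2 := integrable_penalty (Cov := Cov) (θ := θ) hu
  have i3 := integrable_penalty (Cov := Cov) (θ := θ) hf
  have i4 : Integrable (fun g => penalty Cov θ (u g) -
      penalty Cov θ (predictionError Cov lam θ τ ζ g)) (gaussian p) := i2.sub i3
  have h1 : 0 ≤ ∫ g, (ζ * inner ℝ (predictionError Cov lam θ τ ζ g - τ • g)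
      (u g - predictionError Cov lam θ τ ζ g) + lam * (penalty Cov θ (u g) -
        penalty Cov θ (predictionError Cov lam θ τ ζ g))) ∂(gaussian p) :=
    integral_nonneg fun g => predictionError_variational_inequality h hlam hζ g (u g)
  rw [integral_add (i1.const_mul ζ) (i4.const_mul lam), integral_const_mul,
    integral_const_mul, integral_sub i2 i3] at h1
  have := mul_nonneg hr h1
  linarith

lemma IsFixedPoint.noiseLevel_eq (hfp : IsFixedPoint n Cov σ lam θ τ ζ)
    (hf : MemLp (predictionError Cov lam θ τ ζ) 2 (gaussian p)) :
    noiseLevel σ (1 / (n : ℝ)) (hf.toLp _) = τ := by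
  obtain ⟨h1, _, h3, _⟩ := hfp
  rw [noiseLevel, ← risk_eq, ← h3, Real.sqrt_sq h1.le]

lemma IsFixedPoint.gap_eq (hfp : IsFixedPoint n Cov σ lam θ τ ζ)
    (hf : MemLp (predictionError Cov lam θ τ ζ) 2 (gaussian p)) :
    gap σ (1 / (n : ℝ)) (noise p) (hf.toLp _) = ζ * τ := by
  rw [gap, hfp.noiseLevel_eq hf]
  obtain ⟨h1, _, _, h4⟩ := hfp
  rw [degreesOfFreedom_eq hf] at h4
  generalize inner ℝ (noise p) (hf.toLp _) = x at h4 ⊢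
  rw [h4]
  -- For `n = 0` the reciprocals are `0` by convention and both sides equal `τ`.
  by_cases hn : (n : ℝ) = 0
  · simp [hn]
  · field_simp

lemma IsFixedPoint.unique (hn : 0 < n) (hσ : 0 < σ ^ 2)
    (h : IsSymmInversePair (act (CFC.sqrt Cov)) (act (CFC.sqrt Cov)⁻¹) k K) (hlam : 0 < lam)
    {τ' ζ' : ℝ} (h1 : IsFixedPoint n Cov σ lam θ τ ζ) (h2 : IsFixedPoint n Cov σ lam θ τ' ζ') :
    τ' = τ ∧ ζ' = ζ := by
  have hr : 0 < 1 / (n : ℝ) := by positivity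
  have hz1 := h1.zeta_pos hlam
  have hz2 := h2.zeta_pos hlam
  have hf1 := memLp_predictionError (Cov := Cov) (θ := θ) (τ := τ) hlam hz1
  have hf2 := memLp_predictionError (Cov := Cov) (θ := θ) (τ := τ') hlam hz2
  have v1 := toLp_predictionError_variational_inequality h hlam hz1.le hf1 hr.le (hf2.toLp _)
  have v2 := toLp_predictionError_variational_inequality h hlam hz2.le hf2 hr.le (hf1.toLp _)
  have n1 := h1.noiseLevel_eq hf1
  have n2 := h2.noiseLevel_eq hf2
  have g1 := h1.gap_eq hf1
  have g2 := h2.gap_eq hf2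
  have t1 := h1.1
  have t2 := h2.1
  have key : hf1.toLp _ = hf2.toLp _ := by
    refine eq_of_variational_inequalities (σ := σ) (g := noise p) hσ hr
      (N := meanPenalty Cov θ (1 / (n : ℝ)) lam) ?_ ?_ ?_ ?_
    · rw [g1]; positivity
    · rw [g1, n1, mul_div_cancel_right₀ _ t1.ne']; exact v1
    · rw [g2, n2, mul_div_cancel_right₀ _ t2.ne']; exact v2
    · rw [g2]; positivity
  rw [← key] at n2 g2
  have ht : τ' = τ := n2.symm.trans n1
  refine ⟨ht, ?_⟩
  rw [ht] at g2
  exact mul_right_cancel₀ t1.ne' (g2.symm.trans g1)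

/-- The minimizer and the Lasso prediction error at the induced `(τ, ζ)` solve the same variational
inequality in L². Testing each against the other leaves `-ζ r ‖v - w‖² ≥ 0`, so they agree. -/
lemma isFixedPoint_of_isMin (hn : 0 < n) (hσ : 0 < σ ^ 2)
    (h : IsSymmInversePair (act (CFC.sqrt Cov)) (act (CFC.sqrt Cov)⁻¹) k K) (hlam : 0 < lam)
    {v : ErrorSpace p}
    (hv : ∀ u, cost σ (1 / (n : ℝ)) (noise p) (meanPenalty Cov θ (1 / (n : ℝ)) lam) v ≤
      cost σ (1 / (n : ℝ)) (noise p) (meanPenalty Cov θ (1 / (n : ℝ)) lam) u)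
    (hL : 0 < gap σ (1 / (n : ℝ)) (noise p) v) :
    IsFixedPoint n Cov σ lam θ (noiseLevel σ (1 / (n : ℝ)) v)
      (gap σ (1 / (n : ℝ)) (noise p) v / noiseLevel σ (1 / (n : ℝ)) v) := by
  have hr : 0 < 1 / (n : ℝ) := by positivity
  have hτ := noiseLevel_pos hσ hr.le v
  have hvi := variational_inequality_of_isMin hσ hr.le (convexOn_meanPenalty hr.le hlam.le) hv hL
  set τ := noiseLevel σ (1 / (n : ℝ)) v with hτdef
  set ζ := gap σ (1 / (n : ℝ)) (noise p) v / τ with hζdef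
  have hζ : 0 < ζ := div_pos hL hτ
  have hf := memLp_predictionError (Cov := Cov) (θ := θ) (τ := τ) hlam hζ
  have h1 := hvi (hf.toLp _)
  have h2 := toLp_predictionError_variational_inequality h hlam hζ.le hf hr.le v
  set w := hf.toLp _ with hw
  have e : inner ℝ (v - τ • noise p) (w - v) + inner ℝ (w - τ • noise p) (v - w) =
      -‖v - w‖ ^ 2 := by
    rw [← real_inner_self_eq_norm_sq, ← neg_sub v w, inner_neg_right]
    simp only [inner_sub_left]; ring
  have h3 : 0 ≤ ζ * (1 / (n : ℝ)) * (-‖v - w‖ ^ 2) := by rw [← e]; linarith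
  have h4 : v = w := by
    have h5 := nonneg_of_mul_nonneg_right h3 (by positivity)
    have h6 : ‖v - w‖ = 0 := by nlinarith [norm_nonneg (v - w)]
    exact sub_eq_zero.1 (norm_eq_zero.1 h6)
  refine ⟨hτ, hζ.le, ?_, ?_⟩
  · rw [risk_eq hf, ← hw, ← h4, hτdef, noiseLevel_sq hr.le]
  · rw [degreesOfFreedom_eq hf, ← hw, ← h4]
    nth_rw 1 [hζdef]
    rw [gap, ← hτdef]
    field_simp

end FixedPoint

/-! ### The cone functional and the Gaussian width. -/

section Cone

variable {p : ℕ} {Cov : Matrix (Fin p) (Fin p) ℝ} {x : Fin p → SignType}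
  {f : EuclideanSpace ℝ (Fin p) → EuclideanSpace ℝ (Fin p)}

lemma coneFunctional_eq (v : EuclideanSpace ℝ (Fin p)) :
    coneFunctional x Cov v = ∑ j, ((x j : ℝ) * act (CFC.sqrt Cov)⁻¹ v j +
      if x j = 0 then |act (CFC.sqrt Cov)⁻¹ v j| else 0) := by
  rw [coneFunctional, Finset.sum_add_distrib, Finset.sum_filter]

lemma coneFunctional_smul {t : ℝ} (ht : 0 ≤ t) (v : EuclideanSpace ℝ (Fin p)) :
    coneFunctional x Cov (t • v) = t * coneFunctional x Cov v := by
  simp only [coneFunctional_eq, Finset.mul_sum, map_smul, PiLp.smul_apply, smul_eq_mul, abs_mul,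
    abs_of_nonneg ht]
  refine Finset.sum_congr rfl fun j _ => ?_
  split_ifs <;> ring

lemma abs_coneFunctional_le (v : EuclideanSpace ℝ (Fin p)) :
    |coneFunctional x Cov v| ≤ l1Norm (act (CFC.sqrt Cov)⁻¹ v) := by
  rw [coneFunctional_eq, l1Norm]
  refine (Finset.abs_sum_le_sum_abs _ _).trans (Finset.sum_le_sum fun j _ => ?_)
  rcases h : x j <;> simp

lemma continuous_coneFunctional : Continuous (coneFunctional x Cov) := by
  unfold coneFunctional
  fun_prop

lemma integrable_coneFunctional (hf : MemLp f 2 (gaussian p)) :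
    Integrable (fun g => coneFunctional x Cov (f g)) (gaussian p) :=
  (integrable_l1Norm (memLp_clm_comp (act (CFC.sqrt Cov)⁻¹) hf)).mono'
    (continuous_coneFunctional.comp_aestronglyMeasurable hf.1)
    (Filter.Eventually.of_forall fun _ => abs_coneFunctional_le _)

/-- A sign vector as a real vector. -/
noncomputable def signVector (x : Fin p → SignType) : EuclideanSpace ℝ (Fin p) :=
  WithLp.toLp 2 fun j => (x j : ℝ)

lemma sq_signType (a : SignType) : (a : ℝ) * a = if a ≠ 0 then 1 else 0 := by
  rcases a <;> simp

/-- On the support `x j ^ 2 = 1`, off it the shift vanishes. With `s` proportional to `p`, a bounded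
`t` therefore restores the cone constraint. -/
lemma coneFunctional_sub_smul_signVector {k K : ℝ}
    (h : IsSymmInversePair (act (CFC.sqrt Cov)) (act (CFC.sqrt Cov)⁻¹) k K)
    (t : ℝ) (v : EuclideanSpace ℝ (Fin p)) :
    coneFunctional x Cov (v - t • act (CFC.sqrt Cov) (signVector x)) =
      coneFunctional x Cov v - t * (Finset.univ.filter fun j => x j ≠ 0).card := by
  rw [coneFunctional_eq, coneFunctional_eq, map_sub, map_smul, h.inv_apply, Finset.card_filter,
    Nat.cast_sum, Finset.mul_sum, ← Finset.sum_sub_distrib]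
  refine Finset.sum_congr rfl fun j _ => ?_
  have e : (act (CFC.sqrt Cov)⁻¹ v - t • signVector x) j =
      act (CFC.sqrt Cov)⁻¹ v j - t * (x j : ℝ) := rfl
  rw [e]
  generalize x j = a
  rcases a
  all_goals simp
  all_goals ring

lemma norm_signVector_sq_le : ‖signVector x‖ ^ 2 ≤ p := by
  rw [EuclideanSpace.real_norm_sq_eq]
  calc ∑ j, signVector x j ^ 2 ≤ ∑ _j : Fin p, (1 : ℝ) := by
        refine Finset.sum_le_sum fun j _ => ?_
        rw [sq]; change (x j : ℝ) * (x j : ℝ) ≤ 1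
        rw [sq_signType]; split_ifs <;> norm_num
    _ = p := by simp

/-- The subgradient inequality for the `ℓ₁` norm at `θbar`; moving from `θbar` to `θ` costs the
distance twice. -/
lemma penalty_ge {θ θbar : EuclideanSpace ℝ (Fin p)} (hx : ∀ j, x j = SignType.sign (θbar j))
    (v : EuclideanSpace ℝ (Fin p)) :
    l1Norm θ + coneFunctional x Cov v - 2 * l1Norm (θbar - θ) ≤ penalty Cov θ v := by
  unfold penalty
  set w := act (CFC.sqrt Cov)⁻¹ v with hw
  have h1 : l1Norm (θbar + w) ≤ l1Norm (θ + w) + l1Norm (θbar - θ) := by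
    refine le_trans (le_of_eq ?_) (l1Norm_add_le _ _); congr 1; abel
  have h2 : l1Norm θ ≤ l1Norm θbar + l1Norm (θbar - θ) := by
    have e : l1Norm (θbar - θ) = l1Norm (θ - θbar) := by
      unfold l1Norm
      exact Finset.sum_congr rfl fun j _ => abs_sub_comm _ _
    rw [e]
    refine le_trans (le_of_eq ?_) (l1Norm_add_le _ _); congr 1; abel
  have h3 : l1Norm θbar + coneFunctional x Cov v ≤ l1Norm (θbar + w) := by
    rw [coneFunctional_eq, ← hw, l1Norm, l1Norm, ← Finset.sum_add_distrib]
    refine Finset.sum_le_sum fun j _ => ?_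
    rw [hx j, PiLp.add_apply]
    rcases lt_trichotomy (θbar j) 0 with h | h | h
    · rw [sign_neg h, abs_of_neg h]
      simp
      linarith [neg_abs_le (θbar j + w j)]
    · rw [h]; simp
    · rw [sign_pos h, abs_of_pos h]
      simp
      linarith [le_abs_self (θbar j + w j)]
  linarith

/-- Correlation and cone constraint are positively homogeneous, so `f` may be rescaled to norm `√p`.
-/
lemma integral_inner_le_of_gaussianWidth_le (hp : 0 < p) {G : ℝ} (hG : gaussianWidth x Cov ≤ G)
    (hf : MemLp f 2 (gaussian p)) (hc : ∫ g, coneFunctional x Cov (f g) ∂(gaussian p) ≤ 0) :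
    inner ℝ (noise p) (hf.toLp f) ≤ Real.sqrt p * G * ‖hf.toLp f‖ := by
  have hp' : (0 : ℝ) < p := by exact_mod_cast hp
  rcases (norm_nonneg (hf.toLp f)).eq_or_lt with h0 | h0
  · rw [← h0, norm_eq_zero.1 h0.symm]; simp
  set N := ‖hf.toLp f‖ with hN
  set t := Real.sqrt p / N with ht
  have ht0 : 0 < t := by positivity
  -- Needed because `sSup` of an unbounded set of reals is `0`; Cauchy–Schwarz and `‖g‖² = p` in L²
  -- bound every competitor by `1`.
  have hbdd : BddAbove {r : ℝ | ∃ v : EuclideanSpace ℝ (Fin p) → EuclideanSpace ℝ (Fin p),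
      MemLp v 2 (gaussian p) ∧
      ∫ g, ‖v g‖ ^ 2 ∂(gaussian p) ≤ p ∧
      ∫ g, coneFunctional x Cov (v g) ∂(gaussian p) ≤ 0 ∧
      r = 1 / (p : ℝ) * ∫ g, inner ℝ (v g) g ∂(gaussian p)} := by
    refine ⟨1, ?_⟩
    rintro _ ⟨v, hv, hv2, -, rfl⟩
    rw [← inner_noise_toLp hv, one_div, inv_mul_le_iff₀ hp', mul_one]
    rw [← norm_toLp_sq hv] at hv2
    have h1 := real_inner_le_norm (noise p) (hv.toLp v)
    have h2 := norm_noise_sq (p := p)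
    nlinarith [sq_nonneg (‖noise p‖ - ‖hv.toLp v‖)]
  have hmem : 1 / (p : ℝ) * ∫ g, inner ℝ (t • f g) g ∂(gaussian p) ≤ gaussianWidth x Cov := by
    refine le_csSup hbdd ⟨fun g => t • f g, hf.const_smul t, ?_, ?_, rfl⟩
    · have : ∀ g, ‖t • f g‖ ^ 2 = t ^ 2 * ‖f g‖ ^ 2 := fun g => by
        rw [norm_smul, mul_pow, Real.norm_eq_abs, sq_abs]
      simp_rw [this]
      rw [integral_const_mul, ← norm_toLp_sq hf, ← hN, ht, div_pow, Real.sq_sqrt hp'.le,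
        div_mul_cancel₀ _ (by positivity)]
    · simp_rw [coneFunctional_smul ht0.le]
      rw [integral_const_mul]
      exact mul_nonpos_of_nonneg_of_nonpos ht0.le hc
  have h1 := hmem.trans hG
  simp_rw [real_inner_smul_left] at h1
  rw [integral_const_mul, ← inner_noise_toLp hf, ht] at h1
  have h2 : inner ℝ (noise p) (hf.toLp f) =
      Real.sqrt p * N * (1 / (p : ℝ) * (Real.sqrt p / N * inner ℝ (noise p) (hf.toLp f))) := by
    have := Real.mul_self_sqrt hp'.le
    field_simp
    rw [sq, this]
  rw [h2]
  calc _ ≤ Real.sqrt p * N * G := by gcongr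
    _ = _ := by ring

end Cone

/-! ### Norm bound for near-minimizers. -/

/-- The hypotheses on the model under which the fixed point equations are analysed. -/
structure IsAdmissible (lamMin lamMax κMin κMax σMin σMax δ νMin ΔMin M : ℝ) (n : ℕ) {p : ℕ}
    (Cov : Matrix (Fin p) (Fin p) ℝ) (σ lam : ℝ) (θ : EuclideanSpace ℝ (Fin p)) : Prop where
  ratio : (n : ℝ) / (p : ℝ) = δ
  pair : IsSymmInversePair (act (CFC.sqrt Cov)) (act (CFC.sqrt Cov)⁻¹) κMin κMax
  lam_lower : lamMin ≤ lam
  lam_upper : lam ≤ lamMax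
  noise_lower : σMin ^ 2 ≤ σ ^ 2
  noise_upper : σ ^ 2 ≤ σMax ^ 2
  sparse : ∃ s : ℕ, νMin ≤ (s : ℝ) / (p : ℝ) ∧
    IsApproxSparse Cov θ s (Real.sqrt δ * (1 - ΔMin)) M

/-- The convex cost attached to the fixed point equations. -/
noncomputable abbrev modelCost (n : ℕ) {p : ℕ} (Cov : Matrix (Fin p) (Fin p) ℝ) (σ lam : ℝ)
    (θ : EuclideanSpace ℝ (Fin p)) : ErrorSpace p → ℝ :=
  cost σ (1 / (n : ℝ)) (noise p) (meanPenalty Cov θ (1 / (n : ℝ)) lam)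

/-- For large `u` the square of `Δ u - C` outgrows any affine function. -/
lemma le_of_sq_max_le_affine {u L Δ C a b : ℝ} (hΔ : 0 < Δ) (hΔ1 : Δ ≤ 1) (hC : 0 ≤ C)
    (ha : 0 ≤ a) (hb : 0 ≤ b) (hL : Δ * u - C ≤ L) (h : max L 0 ^ 2 ≤ a + b * u) :
    u ≤ 1 + C / Δ + (a + b + 2 * C) / Δ ^ 2 := by
  by_contra! hu
  have h1 : 0 ≤ C / Δ := by positivity
  have h2 : 0 ≤ (a + b + 2 * C) / Δ ^ 2 := by positivity
  have hu1 : 1 < u := by linarith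
  have hu2 : C < Δ * u := by
    have : C / Δ < u := by linarith
    rw [div_lt_iff₀ hΔ] at this; linarith
  have hu3 : a + b + 2 * C < u * Δ ^ 2 := by
    have : (a + b + 2 * C) / Δ ^ 2 < u := by linarith
    rwa [div_lt_iff₀ (by positivity)] at this
  have h3 : (Δ * u - C) ^ 2 ≤ a + b * u := by
    refine le_trans ?_ h
    have : Δ * u - C ≤ max L 0 := hL.trans (le_max_left _ _)
    gcongr
  have h4 : Δ * C * u ≤ 1 * C * u := by gcongr
  have h5 : a * 1 ≤ a * u := by gcongr
  nlinarith [mul_lt_mul_of_pos_right hu3 (by linarith : 0 < u), sq_nonneg C]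

section Bounds

variable {lamMin lamMax κMin κMax σMin σMax δ νMin ΔMin M : ℝ}

namespace IsAdmissible

variable {n p : ℕ} {Cov : Matrix (Fin p) (Fin p) ℝ} {σ lam : ℝ} {θ : EuclideanSpace ℝ (Fin p)}

/-- `p = 0` would make the ratio `0` by the convention on division. -/
lemma p_pos (h : IsAdmissible lamMin lamMax κMin κMax σMin σMax δ νMin ΔMin M n Cov σ lam θ)
    (hδ : 0 < δ) : (0 : ℝ) < p := by
  rcases Nat.eq_zero_or_pos p with h0 | h0
  · have := h.ratio; subst h0; simp at this; linarith
  · exact_mod_cast h0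

lemma n_eq (h : IsAdmissible lamMin lamMax κMin κMax σMin σMax δ νMin ΔMin M n Cov σ lam θ)
    (hδ : 0 < δ) : (n : ℝ) = δ * p := by
  rw [← h.ratio, div_mul_cancel₀ _ (h.p_pos hδ).ne']

lemma n_pos (h : IsAdmissible lamMin lamMax κMin κMax σMin σMax δ νMin ΔMin M n Cov σ lam θ)
    (hδ : 0 < δ) : (0 : ℝ) < n := by
  rw [h.n_eq hδ]; exact mul_pos hδ (h.p_pos hδ)

lemma sqrt_mul_sqrt (h : IsAdmissible lamMin lamMax κMin κMax σMin σMax δ νMin ΔMin M n Cov σ lam θ)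
    (hδ : 0 < δ) : Real.sqrt (1 / (n : ℝ)) * Real.sqrt p = 1 / Real.sqrt δ := by
  have hp := h.p_pos hδ
  rw [← Real.sqrt_mul (by positivity), h.n_eq hδ, one_div, one_div, ← Real.sqrt_inv]
  congr 1
  field_simp

/-- Comparison with zero error: `‖θ‖₁` appears in both costs and cancels, so no bound on `θ` is
required. -/
lemma integral_cone_upper
    (h : IsAdmissible lamMin lamMax κMin κMax σMin σMax δ νMin ΔMin M n Cov σ lam θ)
    (hlamMin : 0 < lamMin) (hδ : 0 < δ) {v : ErrorSpace p}
    (hv : modelCost n Cov σ lam θ v ≤ modelCost n Cov σ lam θ 0 + 1) {x : Fin p → SignType}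
    {θbar : EuclideanSpace ℝ (Fin p)} (hx : ∀ j, x j = SignType.sign (θbar j))
    (hM : 1 / (p : ℝ) * l1Norm (θbar - θ) ≤ M) :
    max (gap σ (1 / (n : ℝ)) (noise p) v) 0 ^ 2 / 2 +
      1 / (n : ℝ) * lam * (∫ g, coneFunctional x Cov (v g) ∂(gaussian p) - 2 * (p * M)) ≤
        σMax ^ 2 / 2 + 1 := by
  have hp := h.p_pos hδ
  have hn := h.n_pos hδ
  have hlam : 0 < lam := hlamMin.trans_le h.lam_lower
  have hvL : MemLp (fun g => v g) 2 (gaussian p) := Lp.memLp v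
  have hMp : l1Norm (θbar - θ) ≤ p * M := by
    rw [one_div, inv_mul_le_iff₀ hp] at hM; exact hM
  have h0 : meanPenalty Cov θ (1 / (n : ℝ)) lam 0 = 1 / (n : ℝ) * lam * l1Norm θ := by
    have hz : MemLp (fun _ : EuclideanSpace ℝ (Fin p) => (0 : EuclideanSpace ℝ (Fin p))) 2
        (gaussian p) := memLp_const 0
    have e : (0 : ErrorSpace p) = hz.toLp _ := rfl
    rw [e, meanPenalty_toLp]
    simp [penalty]
  have h1 : l1Norm θ + ∫ g, coneFunctional x Cov (v g) ∂(gaussian p) - 2 * (p * M) ≤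
      ∫ g, penalty Cov θ (v g) ∂(gaussian p) := by
    have hi := integrable_coneFunctional (x := x) (Cov := Cov) hvL
    have hi' : Integrable (fun g => l1Norm θ + coneFunctional x Cov (v g)) (gaussian p) :=
      (integrable_const (l1Norm θ)).add hi
    have := integral_mono (hi'.sub (integrable_const (2 * l1Norm (θbar - θ))))
      (integrable_penalty (Cov := Cov) (θ := θ) hvL) (fun g => penalty_ge hx (v g))
    simp only [Pi.sub_apply] at this
    rw [integral_sub hi' (integrable_const _), integral_add (integrable_const _) hi] at this
    simp at this
    linarith
  have h2 : gap σ (1 / (n : ℝ)) (noise p) 0 = noiseLevel σ (1 / (n : ℝ)) (0 : ErrorSpace p) := by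
    simp [gap]
  have h3 : noiseLevel σ (1 / (n : ℝ)) (0 : ErrorSpace p) ^ 2 = σ ^ 2 := by
    rw [noiseLevel_sq (by positivity)]; simp
  unfold modelCost cost at hv
  rw [h0, h2, max_eq_left (noiseLevel_nonneg _), h3] at hv
  unfold meanPenalty at hv
  have h4 : 0 < 1 / (n : ℝ) * lam := by positivity
  have h5 := mul_le_mul_of_nonneg_left h1 h4.le
  have h6 := h.noise_upper
  linarith

end IsAdmissible

lemma exists_norm_bound (hlamMin : 0 < lamMin) (hlam : lamMin ≤ lamMax) (hκMin : 0 < κMin)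
    (hδ : 0 < δ) (hνMin : 0 < νMin) (hΔMin : 0 < ΔMin) (hΔMin1 : ΔMin ≤ 1) (hM : 0 ≤ M) :
    ∃ U : ℝ, 0 ≤ U ∧ ∀ (n p : ℕ) (Cov : Matrix (Fin p) (Fin p) ℝ) (σ lam : ℝ)
      (θ : EuclideanSpace ℝ (Fin p)),
      IsAdmissible lamMin lamMax κMin κMax σMin σMax δ νMin ΔMin M n Cov σ lam θ →
      ∀ v : ErrorSpace p, modelCost n Cov σ lam θ v ≤ modelCost n Cov σ lam θ 0 + 1 →
        Real.sqrt (1 / (n : ℝ)) * ‖v‖ ≤ U := by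
  have hlamMax : 0 < lamMax := hlamMin.trans_le hlam
  -- `C1 * p` bounds the mean cone functional, `C2` the effect of the shift along the sign vector,
  -- and `a + b * u` the squared positive part of `gap`.
  set C1 := 2 * M + δ * (σMax ^ 2 / 2 + 1) / lamMin with hC1
  set C2 := 1 / Real.sqrt δ * (C1 / νMin) * Real.sqrt κMax with hC2
  set a := σMax ^ 2 + 2 + 4 * lamMax * M / δ with ha
  set b := 2 * lamMax * (1 / Real.sqrt δ * Real.sqrt κMin⁻¹) with hb
  have hC1p : 0 ≤ C1 := by positivity
  have hC2p : 0 ≤ C2 := by positivity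
  have hap : 0 ≤ a := by positivity
  have hbp : 0 ≤ b := by positivity
  refine ⟨1 + C2 / ΔMin + (a + b + 2 * C2) / ΔMin ^ 2, by positivity, ?_⟩
  intro n p Cov σ lam θ h v hv
  have hp := h.p_pos hδ
  have hn := h.n_pos hδ
  have hnp := h.n_eq hδ
  have hlam0 : 0 < lam := hlamMin.trans_le h.lam_lower
  obtain ⟨s, hs, x, ⟨θbar, hθM, hx⟩, hcard, hG⟩ := h.sparse
  have hvL : MemLp (fun g => v g) 2 (gaussian p) := Lp.memLp v
  have hvT : hvL.toLp _ = v := Lp.toLp_coeFn v hvL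
  have hvn : ‖v‖ ^ 2 = ∫ g, ‖v g‖ ^ 2 ∂(gaussian p) := by
    rw [← norm_toLp_sq hvL, hvT]
  have hii := h.integral_cone_upper hlamMin hδ hv hx hθM
  set c := ∫ g, coneFunctional x Cov (v g) ∂(gaussian p) with hc
  set L := gap σ (1 / (n : ℝ)) (noise p) v with hL
  set u := Real.sqrt (1 / (n : ℝ)) * ‖v‖ with hu
  have hu0 : 0 ≤ u := by positivity
  have hsp : νMin * p ≤ s := by rwa [le_div_iff₀ hp] at hs
  have hs0 : (0 : ℝ) < s := (mul_pos hνMin hp).trans_le hsp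
  have hrl : 1 / (n : ℝ) * lam * (2 * (p * M)) = 2 * lam * M / δ := by
    rw [hnp]; field_simp
  have hLsq : 0 ≤ max L 0 ^ 2 / 2 := by positivity
  have hcub : c ≤ C1 * p := by
    have h1 : 1 / (n : ℝ) * lam * (c - 2 * (p * M)) ≤ σMax ^ 2 / 2 + 1 := by linarith
    by_contra! hlt
    have h2 : δ * (σMax ^ 2 / 2 + 1) / lamMin * p < c - 2 * (p * M) := by
      rw [hC1] at hlt; linarith
    have h3 : 1 / (n : ℝ) * lamMin * (δ * (σMax ^ 2 / 2 + 1) / lamMin * p) = σMax ^ 2 / 2 + 1 := by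
      rw [hnp]; field_simp
    have h4 : 1 / (n : ℝ) * lamMin * (δ * (σMax ^ 2 / 2 + 1) / lamMin * p) <
        1 / (n : ℝ) * lam * (c - 2 * (p * M)) := by
      have := h.lam_lower
      have h5 : 0 ≤ δ * (σMax ^ 2 / 2 + 1) / lamMin * p := by positivity
      calc _ ≤ 1 / (n : ℝ) * lam * (δ * (σMax ^ 2 / 2 + 1) / lamMin * p) := by gcongr
        _ < _ := by gcongr
    linarith
  have hclb : -c ≤ Real.sqrt p * (Real.sqrt κMin⁻¹ * ‖v‖) := by
    have hBf := memLp_clm_comp (act (CFC.sqrt Cov)⁻¹) hvL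
    have h1 : -c ≤ ∫ g, l1Norm (act (CFC.sqrt Cov)⁻¹ (v g)) ∂(gaussian p) := by
      rw [hc, ← integral_neg]
      exact integral_mono (integrable_coneFunctional hvL).neg (integrable_l1Norm hBf)
        fun g => (neg_le_abs _).trans (abs_coneFunctional_le _)
    refine h1.trans ((integral_l1Norm_le hBf).trans ?_)
    gcongr
    refine abs_le_of_sq_le_sq' ?_ (by positivity) |>.2
    rw [mul_pow, Real.sq_sqrt (by positivity), norm_toLp_sq, hvn,
      ← integral_const_mul]
    exact integral_mono ((memLp_two_iff_integrable_sq_norm hBf.1).1 hBf)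
      (((memLp_two_iff_integrable_sq_norm hvL.1).1 hvL).const_mul _)
      fun g => h.pair.inv_upper hκMin _
  have hsqrt := h.sqrt_mul_sqrt hδ
  have hsqr : Real.sqrt (1 / (n : ℝ)) * Real.sqrt (1 / (n : ℝ)) = 1 / (n : ℝ) :=
    Real.mul_self_sqrt (by positivity)
  have hquad : max L 0 ^ 2 ≤ a + b * u := by
    have h1 : 1 / (n : ℝ) * lam * (-c) ≤ lamMax * (1 / Real.sqrt δ * Real.sqrt κMin⁻¹) * u := by
      have := h.lam_upper
      calc 1 / (n : ℝ) * lam * (-c)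
          ≤ 1 / (n : ℝ) * lam * (Real.sqrt p * (Real.sqrt κMin⁻¹ * ‖v‖)) := by gcongr
        _ ≤ 1 / (n : ℝ) * lamMax * (Real.sqrt p * (Real.sqrt κMin⁻¹ * ‖v‖)) := by gcongr
        _ = _ := by
          rw [← hsqrt, hu]
          linear_combination (-(lamMax * (Real.sqrt p * (Real.sqrt κMin⁻¹ * ‖v‖)))) * hsqr
    have h2 : 2 * lam * M / δ ≤ 2 * lamMax * M / δ := by
      have := h.lam_upper
      gcongr
    have e1 : a = σMax ^ 2 + 2 + 2 * (2 * lamMax * M / δ) := by rw [ha]; ring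
    have e2 : b * u = 2 * (lamMax * (1 / Real.sqrt δ * Real.sqrt κMin⁻¹) * u) := by rw [hb]; ring
    rw [e1, e2]
    linarith
  refine le_of_sq_max_le_affine hΔMin hΔMin1 hC2p hap hbp (L := L) ?_ hquad
  -- subtracting a multiple of the sign vector makes the cone functional nonpositive
  set t := max c 0 / s with ht
  have ht0 : 0 ≤ t := by positivity
  have htub : t ≤ C1 / νMin := by
    rw [ht, div_le_div_iff₀ hs0 hνMin]
    calc max c 0 * νMin ≤ (C1 * p) * νMin := by
          gcongr; exact max_le hcub (by positivity)
      _ = C1 * (νMin * p) := by ring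
      _ ≤ _ := by gcongr
  set z := act (CFC.sqrt Cov) (signVector x) with hz
  have hzn : ‖z‖ ≤ Real.sqrt κMax * Real.sqrt p := by
    have h1 := h.pair.upper (signVector x)
    have h2 := norm_signVector_sq_le (x := x)
    rw [← hz] at h1
    have hk : 0 ≤ κMax := by
      by_contra! hk
      have h3 := h.pair.lower (EuclideanSpace.single ⟨0, by exact_mod_cast hp⟩ 1)
      have h4 := h.pair.upper (EuclideanSpace.single ⟨0, by exact_mod_cast hp⟩ 1)
      simp at h3 h4
      linarith
    refine abs_le_of_sq_le_sq' ?_ (by positivity) |>.2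
    rw [mul_pow, Real.sq_sqrt hk, Real.sq_sqrt hp.le]
    exact h1.trans (by gcongr)
  have hzL : MemLp (fun _ : EuclideanSpace ℝ (Fin p) => t • z) 2 (gaussian p) := memLp_const _
  have hfL : MemLp (fun g => v g - t • z) 2 (gaussian p) := hvL.sub hzL
  have hfT : hfL.toLp _ = v - hzL.toLp _ := by
    have e : hfL.toLp _ = hvL.toLp _ - hzL.toLp _ := rfl
    rw [e, hvT]
  have hzT : ‖hzL.toLp _‖ = t * ‖z‖ := by
    have h1 : ‖hzL.toLp _‖ ^ 2 = (t * ‖z‖) ^ 2 := by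
      rw [norm_toLp_sq]; simp [norm_smul, abs_of_nonneg ht0]
    exact (pow_left_inj₀ (norm_nonneg _) (by positivity) two_ne_zero).1 h1
  have hcone : ∫ g, coneFunctional x Cov (v g - t • z) ∂(gaussian p) ≤ 0 := by
    simp_rw [hz, coneFunctional_sub_smul_signVector h.pair]
    rw [integral_sub (integrable_coneFunctional hvL) (integrable_const _), ← hc, hcard]
    simp only [integral_const, probReal_univ, smul_eq_mul, one_mul]
    rw [ht, div_mul_cancel₀ _ hs0.ne']
    linarith [le_max_left c 0]
  have hw := integral_inner_le_of_gaussianWidth_le (by exact_mod_cast hp) hG hfL hcone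
  -- The subtracted vector is deterministic, hence uncorrelated with the noise.
  have hin : inner ℝ (noise p) (hfL.toLp _) = inner ℝ (noise p) v := by
    rw [hfT, inner_sub_right, inner_noise_toLp hzL, integral_inner_gaussian, sub_zero]
  have hnf : ‖hfL.toLp _‖ ≤ ‖v‖ + t * (Real.sqrt κMax * Real.sqrt p) := by
    rw [hfT]
    refine (norm_sub_le _ _).trans ?_
    rw [hzT]; gcongr
  rw [hin] at hw
  have hone : Real.sqrt (1 / (n : ℝ)) * Real.sqrt p * Real.sqrt δ = 1 := by
    rw [hsqrt, one_div_mul_cancel (Real.sqrt_pos.2 hδ).ne']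
  have hcorr : 1 / (n : ℝ) * inner ℝ (noise p) v ≤ (1 - ΔMin) * u + C2 := by
    have h1d : 0 ≤ 1 - ΔMin := by linarith
    calc 1 / (n : ℝ) * inner ℝ (noise p) v
        ≤ 1 / (n : ℝ) * (Real.sqrt p * (Real.sqrt δ * (1 - ΔMin)) *
          (‖v‖ + t * (Real.sqrt κMax * Real.sqrt p))) := by
          have := hw.trans (mul_le_mul_of_nonneg_left hnf (by positivity))
          gcongr
      _ = (Real.sqrt (1 / (n : ℝ)) * Real.sqrt p * Real.sqrt δ) * (1 - ΔMin) *
          (u + (Real.sqrt (1 / (n : ℝ)) * Real.sqrt p) * t * Real.sqrt κMax) := by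
          rw [hu]
          linear_combination (-(Real.sqrt p * (Real.sqrt δ * (1 - ΔMin)) *
            (‖v‖ + t * (Real.sqrt κMax * Real.sqrt p)))) * hsqr
      _ = (1 - ΔMin) * u + (1 - ΔMin) * (1 / Real.sqrt δ * t * Real.sqrt κMax) := by
          rw [hone, hsqrt]; ring
      _ ≤ (1 - ΔMin) * u + 1 * (1 / Real.sqrt δ * (C1 / νMin) * Real.sqrt κMax) := by
          gcongr; linarith
      _ = _ := by rw [one_mul]
  have hnl := sqrt_mul_norm_le_noiseLevel (σ := σ) (r := 1 / (n : ℝ)) (by positivity) v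
  rw [hL, gap]
  linarith

end Bounds

/-! ### Truncation, a bounded direction that decreases the `ℓ₁` norm. -/

section Clip

variable {p : ℕ}

/-- Entrywise truncation to `[-1, 1]`. -/
noncomputable def clip (θ : EuclideanSpace ℝ (Fin p)) : EuclideanSpace ℝ (Fin p) :=
  WithLp.toLp 2 fun j => max (-1) (min (θ j) 1)

lemma clip_apply (θ : EuclideanSpace ℝ (Fin p)) (j : Fin p) :
    clip θ j = max (-1) (min (θ j) 1) := rfl

lemma continuous_clip : Continuous (clip (p := p)) := by
  unfold clip; fun_prop

lemma norm_clip_sq_le (θ : EuclideanSpace ℝ (Fin p)) : ‖clip θ‖ ^ 2 ≤ p := by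
  rw [EuclideanSpace.real_norm_sq_eq]
  calc ∑ j, clip θ j ^ 2 ≤ ∑ _j : Fin p, (1 : ℝ) := by
        refine Finset.sum_le_sum fun j _ => ?_
        rw [clip_apply, sq_le_one_iff_abs_le_one, abs_le]
        exact ⟨le_max_left _ _, max_le (by norm_num) (min_le_right _ _)⟩
    _ = p := by simp

lemma abs_sub_mul_clip_le {t : ℝ} (ht1 : t ≤ 1) (y : ℝ) :
    |y - t * max (-1) (min y 1)| ≤ |y| - t * min |y| 1 := by
  rcases le_total y (-1) with h | h
  · rw [min_eq_left (by linarith), max_eq_left h, abs_of_nonpos (by linarith : y ≤ 0),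
      min_eq_right (by linarith), abs_le]
    constructor <;> linarith
  rcases le_total y 1 with h1 | h1
  · rw [min_eq_left h1, max_eq_right h, min_eq_left (abs_le.2 ⟨h, h1⟩)]
    have : y - t * y = (1 - t) * y := by ring
    rw [this, abs_mul, abs_of_nonneg (sub_nonneg.2 ht1)]
    linarith
  · rw [min_eq_right h1, max_eq_right (by norm_num), abs_of_nonneg (by linarith : 0 ≤ y),
      min_eq_right h1, abs_le]
    constructor <;> linarith

lemma l1Norm_sub_smul_clip_le {t : ℝ} (ht1 : t ≤ 1) (θ : EuclideanSpace ℝ (Fin p)) :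
    l1Norm (θ - t • clip θ) ≤ l1Norm θ - t * ∑ j, min |θ j| 1 := by
  unfold l1Norm
  rw [Finset.mul_sum, ← Finset.sum_sub_distrib]
  exact Finset.sum_le_sum fun j _ => abs_sub_mul_clip_le ht1 _

end Clip

/-! ### Small variables have small correlation with the noise. -/

section Correlation

lemma mul_le_of_min_abs {a : ℝ} (ha : 0 < a) (y h : ℝ) :
    y * h ≤ a / 2 * (1 + y ^ 2) + 1 / (2 * a) * (min |y| 1 * h ^ 2) := by
  have h1 : y * h ≤ |y| * |h| := by rw [← abs_mul]; exact le_abs_self _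
  have h2 : ∀ z : ℝ, z * |h| ≤ a / 2 + 1 / (2 * a) * (z ^ 2 * h ^ 2) := fun z => by
    have : a / 2 + 1 / (2 * a) * (z ^ 2 * h ^ 2) - z * |h| = (a - z * |h|) ^ 2 / (2 * a) := by
      rw [← sq_abs h]; field_simp; ring
    have h3 : 0 ≤ (a - z * |h|) ^ 2 / (2 * a) := by positivity
    linarith
  rcases le_total |y| 1 with hy | hy
  · rw [min_eq_left hy]
    have h3 : |y| ^ 2 * h ^ 2 ≤ |y| * h ^ 2 := by
      gcongr; nlinarith [abs_nonneg y]
    have h4 : 1 / (2 * a) * (|y| ^ 2 * h ^ 2) ≤ 1 / (2 * a) * (|y| * h ^ 2) := by gcongr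
    nlinarith [h2 |y|, mul_nonneg ha.le (sq_nonneg y)]
  · rw [min_eq_right hy]
    have h5 : |y| * |h| ≤ a / 2 * y ^ 2 + 1 / (2 * a) * (1 * h ^ 2) := by
      have : a / 2 * y ^ 2 + 1 / (2 * a) * (1 * h ^ 2) - |y| * |h| =
          (a * |y| - |h|) ^ 2 / (2 * a) := by
        rw [← sq_abs h, ← sq_abs y]; field_simp; ring
      have h3 : 0 ≤ (a * |y| - |h|) ^ 2 / (2 * a) := by positivity
      linarith
    linarith

lemma min_abs_mul_sq_le {b : ℝ} (hb : 0 < b) (y h : ℝ) :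
    min |y| 1 * h ^ 2 ≤ 1 / (2 * b) * min |y| 1 + b / 2 * h ^ 4 := by
  have hm0 : 0 ≤ min |y| 1 := le_min (abs_nonneg y) zero_le_one
  have hm1 : min |y| 1 ≤ 1 := min_le_right _ _
  set m := min |y| 1
  have h1 : 1 / (2 * b) * m ^ 2 + b / 2 * h ^ 4 - m * h ^ 2 = (m - b * h ^ 2) ^ 2 / (2 * b) := by
    field_simp; ring
  have h2 : 0 ≤ (m - b * h ^ 2) ^ 2 / (2 * b) := by positivity
  have h3 : 1 / (2 * b) * m ^ 2 ≤ 1 / (2 * b) * m := by gcongr; nlinarith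
  linarith

/-- Where `c + X` is small, `c` is comparable with `X`; this eliminates the unbounded coordinates `c
= θ j`. -/
lemma one_sub_min_abs_mul_sq_le (c X : ℝ) : (1 - min |c + X| 1) * c ^ 2 ≤ 2 + 2 * X ^ 2 := by
  rcases le_total |c + X| 1 with h | h
  · rw [min_eq_left h]
    have h1 : c ^ 2 ≤ 2 * (c + X) ^ 2 + 2 * X ^ 2 := by nlinarith [sq_nonneg (c + 2 * X)]
    have h2 : (c + X) ^ 2 ≤ 1 := by rwa [sq_le_one_iff_abs_le_one]
    nlinarith [abs_nonneg (c + X), sq_nonneg c]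
  · rw [min_eq_right h]; nlinarith [sq_nonneg X]

/-- If `c + X` is mostly small then `X` is nearly uncorrelated with any centred `h` having a
bounded fourth moment. -/
lemma integral_mul_le_of_min_abs {Ω : Type*} [MeasurableSpace Ω] {μ : Measure Ω}
    [IsProbabilityMeasure μ] {X h : Ω → ℝ} (hX : MemLp X 2 μ) (hh : MemLp h 2 μ)
    (hh4 : Integrable (fun g => h g ^ 4) μ) (h0 : ∫ g, h g ∂μ = 0) {K Q c a b : ℝ}
    (hK : ∫ g, h g ^ 2 ∂μ ≤ K) (hQ : ∫ g, h g ^ 4 ∂μ ≤ Q) (ha : 0 < a) (hb : 0 < b) :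
    ∫ g, X g * h g ∂μ ≤ a / 2 * (9 + 10 * ∫ g, X g ^ 2 ∂μ) +
      1 / (2 * a) * ((∫ g, min |c + X g| 1 ∂μ) * (2 * K + 1 / (2 * b)) + b / 2 * Q) := by
  have iX2 := hX.integrable_sq
  have ih2 := hh.integrable_sq
  have iX := hX.integrable (by norm_num)
  have ih := hh.integrable (by norm_num)
  have iXh : Integrable (fun g => X g * h g) μ := hX.integrable_mul hh
  have im : Integrable (fun g => min |c + X g| 1) μ := by
    refine (integrable_const (1 : ℝ)).mono' ?_ (Filter.Eventually.of_forall fun g => ?_)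
    · exact (Continuous.comp_aestronglyMeasurable (g := fun y : ℝ => min |c + y| 1)
        (by fun_prop) hX.1)
    · rw [Real.norm_of_nonneg (le_min (abs_nonneg _) zero_le_one)]
      exact min_le_right _ _
  set q := ∫ g, min |c + X g| 1 ∂μ with hq
  have hq0 : 0 ≤ q := integral_nonneg fun g => le_min (abs_nonneg _) zero_le_one
  have hK0 : 0 ≤ K := (integral_nonneg fun g => sq_nonneg (h g)).trans hK
  have hQ0 : 0 ≤ Q := (integral_nonneg fun g => by positivity).trans hQ
  set V := ∫ g, X g ^ 2 ∂μ with hV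
  have hV0 : 0 ≤ V := integral_nonneg fun g => sq_nonneg (X g)
  -- If `q > 1/2`, the second moment of `h` is absorbed by `q * 2K`. Otherwise `c² ≤ 4 + 4V`, and
  -- `X` may be replaced by `c + X` since `h` is centred; the average of `1 + 2c² + 2X²` then gives
  -- `9 + 10V`.
  rcases lt_or_ge (1 / 2) q with hlt | hge
  · have h1 : ∫ g, X g * h g ∂μ ≤ ∫ g, (a / 2 * X g ^ 2 + 1 / (2 * a) * h g ^ 2) ∂μ := by
      refine integral_mono iXh ((iX2.const_mul _).add (ih2.const_mul _)) fun g => ?_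
      have e : a / 2 * X g ^ 2 + 1 / (2 * a) * h g ^ 2 - X g * h g =
          (a * X g - h g) ^ 2 / (2 * a) := by field_simp; ring
      have : 0 ≤ (a * X g - h g) ^ 2 / (2 * a) := by positivity
      change X g * h g ≤ a / 2 * X g ^ 2 + 1 / (2 * a) * h g ^ 2
      linarith
    rw [integral_add (iX2.const_mul _) (ih2.const_mul _), integral_const_mul,
      integral_const_mul] at h1
    have h2 : ∫ g, h g ^ 2 ∂μ ≤ q * (2 * K + 1 / (2 * b)) + b / 2 * Q := by
      have e1 : K ≤ q * (2 * K) := by nlinarith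
      have e2 : 0 ≤ q * (1 / (2 * b)) := by positivity
      have e3 : 0 ≤ b / 2 * Q := by positivity
      linarith
    calc _ ≤ a / 2 * V + 1 / (2 * a) * ∫ g, h g ^ 2 ∂μ := h1
      _ ≤ _ := by gcongr; linarith
  · have hc : c ^ 2 ≤ 4 + 4 * V := by
      have h1 : ∫ g, (1 - min |c + X g| 1) * c ^ 2 ∂μ ≤ ∫ g, (2 + 2 * X g ^ 2) ∂μ :=
        integral_mono (((integrable_const 1).sub im).mul_const _)
          ((integrable_const 2).add (iX2.const_mul 2)) fun g => one_sub_min_abs_mul_sq_le c (X g)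
      rw [integral_mul_const, integral_sub (integrable_const 1) im,
        integral_add (integrable_const 2) (iX2.const_mul 2), integral_const_mul] at h1
      simp only [integral_const, probReal_univ, smul_eq_mul, mul_one, one_mul] at h1
      rw [← hq, ← hV] at h1
      nlinarith [sq_nonneg c]
    have h1 : ∫ g, X g * h g ∂μ = ∫ g, (c + X g) * h g ∂μ := by
      simp_rw [add_mul]
      rw [integral_add (ih.const_mul c) iXh, integral_const_mul, h0, mul_zero, zero_add]
    rw [h1]
    have hpt : ∀ g, (c + X g) * h g ≤ a / 2 * (1 + 2 * c ^ 2 + 2 * X g ^ 2) +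
        1 / (2 * a) * (1 / (2 * b) * min |c + X g| 1 + b / 2 * h g ^ 4) := fun g => by
      refine (mul_le_of_min_abs ha (c + X g) (h g)).trans ?_
      have e1 : 1 + (c + X g) ^ 2 ≤ 1 + 2 * c ^ 2 + 2 * X g ^ 2 := by
        nlinarith [sq_nonneg (c - X g)]
      have e2 := min_abs_mul_sq_le hb (c + X g) (h g)
      gcongr
    have i1 : Integrable (fun g => 1 + 2 * c ^ 2 + 2 * X g ^ 2) μ :=
      (integrable_const _).add (iX2.const_mul 2)
    have i2 : Integrable (fun g => 1 / (2 * b) * min |c + X g| 1 + b / 2 * h g ^ 4) μ :=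
      (im.const_mul _).add (hh4.const_mul _)
    have i3 : Integrable (fun g => (c + X g) * h g) μ := by
      simp_rw [add_mul]
      exact (ih.const_mul c).add iXh
    have h2 := integral_mono i3 ((i1.const_mul (a / 2)).add (i2.const_mul (1 / (2 * a)))) hpt
    simp only [Pi.add_apply] at h2
    rw [integral_add (i1.const_mul _) (i2.const_mul _), integral_const_mul, integral_const_mul,
      integral_add (integrable_const _) (iX2.const_mul 2), integral_const_mul,
      integral_add (im.const_mul _) (hh4.const_mul _), integral_const_mul, integral_const_mul] at h2
    simp only [integral_const, probReal_univ, smul_eq_mul, one_mul] at h2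
    rw [← hq, ← hV] at h2
    refine h2.trans ?_
    have e1 : 1 / (2 * b) * q ≤ q * (2 * K + 1 / (2 * b)) := by
      have : 0 ≤ q * (2 * K) := by positivity
      linarith
    exact add_le_add (mul_le_mul_of_nonneg_left (by linarith) (by positivity))
      (mul_le_mul_of_nonneg_left (add_le_add e1 (by gcongr)) (by positivity))

end Correlation

/-! ### Correlation with the noise bounded by the truncated size. -/

section LowerBound

variable {p : ℕ} {Cov : Matrix (Fin p) (Fin p) ℝ} {θ : EuclideanSpace ℝ (Fin p)} {k K : ℝ}

/-- The expected truncated size `𝔼 ∑ min(|θ̂ⱼ|, 1)` of the estimate with prediction error `v`. -/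
noncomputable def truncatedSize (Cov : Matrix (Fin p) (Fin p) ℝ) (θ : EuclideanSpace ℝ (Fin p))
    (v : ErrorSpace p) : ℝ :=
  ∑ j, ∫ g, min |θ j + act (CFC.sqrt Cov)⁻¹ (v g) j| 1 ∂(gaussian p)

lemma integrable_min_abs {f : EuclideanSpace ℝ (Fin p) → EuclideanSpace ℝ (Fin p)}
    (hf : MemLp f 2 (gaussian p)) (j : Fin p) :
    Integrable (fun g => min |θ j + act (CFC.sqrt Cov)⁻¹ (f g) j| 1) (gaussian p) := by
  refine (integrable_const (1 : ℝ)).mono' ?_ (Filter.Eventually.of_forall fun g => ?_)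
  · exact Continuous.comp_aestronglyMeasurable
      (g := fun y : EuclideanSpace ℝ (Fin p) => min |θ j + act (CFC.sqrt Cov)⁻¹ y j| 1)
      (by fun_prop) hf.1
  · rw [Real.norm_of_nonneg (le_min (abs_nonneg _) zero_le_one)]
    exact min_le_right _ _

/-- `⟨v, g⟩` splits as the sum of `(Σ^(-1/2) v)ⱼ (Σ^(1/2) g)ⱼ`, and the scalar estimate applies to
each coordinate with `c = θ j`. -/
lemma inner_noise_le (h : IsSymmInversePair (act (CFC.sqrt Cov)) (act (CFC.sqrt Cov)⁻¹) k K)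
    (hk : 0 < k) {a b : ℝ} (ha : 0 < a) (hb : 0 < b) (v : ErrorSpace p) :
    inner ℝ (noise p) v ≤ a / 2 * (9 * p + 10 * (k⁻¹ * ‖v‖ ^ 2)) +
      1 / (2 * a) * (truncatedSize Cov θ v * (2 * K + 1 / (2 * b)) +
        b / 2 * (48 * Real.exp (K / 2)) * p) := by
  have hvL : MemLp (fun g => v g) 2 (gaussian p) := Lp.memLp v
  have hvT : hvL.toLp _ = v := Lp.toLp_coeFn v hvL
  have hBf := memLp_clm_comp (act (CFC.sqrt Cov)⁻¹) hvL
  set e : Fin p → EuclideanSpace ℝ (Fin p) := fun j => EuclideanSpace.single j 1 with he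
  set A := act (CFC.sqrt Cov) with hA
  set B := act (CFC.sqrt Cov)⁻¹ with hB
  have hAe : ∀ j, ‖A (e j)‖ ^ 2 ≤ K := fun j => by
    have := h.upper (e j)
    simpa [he] using this
  have hcoord : ∀ j g, (A g) j = inner ℝ (A (e j)) g := fun j g => by
    rw [h.symm]; simp [he, EuclideanSpace.inner_single_left]
  have hXj : ∀ j, MemLp (fun g => B (v g) j) 2 (gaussian p) := fun j => by
    have := hBf.const_inner (𝕜 := ℝ) (e j)
    refine this.ae_eq (Filter.Eventually.of_forall fun g => ?_)
    simp [he, EuclideanSpace.inner_single_left]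
  have hhj : ∀ j, MemLp (fun g => inner ℝ (A (e j)) g) 2 (gaussian p) := fun j =>
    memLp_id_gaussian.const_inner (𝕜 := ℝ) (A (e j))
  have hsum : inner ℝ (noise p) v =
      ∑ j, ∫ g, B (v g) j * inner ℝ (A (e j)) g ∂(gaussian p) := by
    have hi : ∀ j ∈ Finset.univ,
        Integrable (fun g => B (v g) j * inner ℝ (A (e j)) g) (gaussian p) :=
      fun j _ => (hXj j).integrable_mul (hhj j)
    rw [← integral_finsetSum _ hi]
    nth_rw 1 [← hvT]
    rw [inner_noise_toLp]
    refine integral_congr_ae (Filter.Eventually.of_forall fun g => ?_)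
    change inner ℝ (v g) g = ∑ j, B (v g) j * inner ℝ (A (e j)) g
    rw [← h.inner_inv_apply (v g) g, PiLp.inner_apply]
    refine Finset.sum_congr rfl fun j _ => ?_
    rw [← hcoord]; simp [mul_comm]
  have hnorm : ∑ j, ∫ g, B (v g) j ^ 2 ∂(gaussian p) ≤ k⁻¹ * ‖v‖ ^ 2 := by
    rw [← integral_finsetSum _ fun j _ => (hXj j).integrable_sq]
    have e1 : ‖v‖ ^ 2 = ∫ g, ‖v g‖ ^ 2 ∂(gaussian p) := by rw [← norm_toLp_sq hvL, hvT]
    rw [e1, ← integral_const_mul]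
    simp_rw [← EuclideanSpace.real_norm_sq_eq]
    exact integral_mono ((memLp_two_iff_integrable_sq_norm hBf.1).1 hBf)
      (((memLp_two_iff_integrable_sq_norm hvL.1).1 hvL).const_mul _) fun g => h.inv_upper hk _
  have hj : ∀ j, ∫ g, B (v g) j * inner ℝ (A (e j)) g ∂(gaussian p) ≤
      a / 2 * (9 + 10 * ∫ g, B (v g) j ^ 2 ∂(gaussian p)) + 1 / (2 * a) *
      ((∫ g, min |θ j + B (v g) j| 1 ∂(gaussian p)) * (2 * K + 1 / (2 * b)) +
        b / 2 * (48 * Real.exp (K / 2))) := fun j => by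
    refine integral_mul_le_of_min_abs (hXj j) (hhj j) (integrable_inner_pow_four_gaussian _)
      (integral_inner_gaussian _) ?_ ?_ ha hb
    · rw [integral_inner_sq_gaussian]; exact hAe j
    · refine (integral_inner_pow_four_gaussian_le _).trans ?_
      gcongr; exact hAe j
  rw [hsum]
  refine (Finset.sum_le_sum fun j _ => hj j).trans ?_
  rw [Finset.sum_add_distrib, ← Finset.mul_sum, ← Finset.mul_sum, Finset.sum_add_distrib,
    Finset.sum_add_distrib, ← Finset.mul_sum, ← Finset.sum_mul]
  simp only [Finset.sum_const, Finset.card_univ, Fintype.card_fin, nsmul_eq_mul]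
  change _ ≤ a / 2 * _ + 1 / (2 * a) * ((∑ j, ∫ g, min |θ j + B (v g) j| 1 ∂(gaussian p)) * _ + _)
  gcongr ?_ * (?_ + 10 * ?_) + ?_ * (?_ + ?_)
  · linarith
  · exact le_of_eq (by ring)
  · exact le_of_eq (by ring)

end LowerBound

/-! ### Lower bound on `gap` for near-minimizers. -/

section Bounds

variable {lamMin lamMax κMin κMax σMin σMax δ νMin ΔMin M : ℝ}

/-- Competitor: the estimate shrunk by `t` times its truncation. The penalty drops in proportion to
the truncated size, while `gap` rises by at most `t` times a constant. -/
lemma IsAdmissible.truncatedSize_le {n p : ℕ} {Cov : Matrix (Fin p) (Fin p) ℝ} {σ lam : ℝ}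
    {θ : EuclideanSpace ℝ (Fin p)}
    (h : IsAdmissible lamMin lamMax κMin κMax σMin σMax δ νMin ΔMin M n Cov σ lam θ)
    (hlamMin : 0 < lamMin) (hδ : 0 < δ) (hκMax : 0 ≤ κMax) {ε : ℝ} {v : ErrorSpace p}
    (hv : ∀ u, modelCost n Cov σ lam θ v ≤ modelCost n Cov σ lam θ u + ε) {t : ℝ} (ht : 0 ≤ t)
    (ht1 : t ≤ 1) :
    1 / (n : ℝ) * lam * (t * truncatedSize Cov θ v) ≤
      ε + t * (Real.sqrt κMax * (1 / Real.sqrt δ + 1 / δ)) * max (gap σ (1 / (n : ℝ)) (noise p) v) 0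
        + t ^ 2 * (Real.sqrt κMax * (1 / Real.sqrt δ + 1 / δ)) ^ 2 / 2 := by
  have hp := h.p_pos hδ
  have hn := h.n_pos hδ
  have hlam : 0 < lam := hlamMin.trans_le h.lam_lower
  have hvL : MemLp (fun g => v g) 2 (gaussian p) := Lp.memLp v
  have hvT : hvL.toLp _ = v := Lp.toLp_coeFn v hvL
  set C := Real.sqrt κMax * (1 / Real.sqrt δ + 1 / δ) with hC
  have hC0 : 0 ≤ C := by positivity
  set A := act (CFC.sqrt Cov) with hA
  set B := act (CFC.sqrt Cov)⁻¹ with hB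
  set d : EuclideanSpace ℝ (Fin p) → EuclideanSpace ℝ (Fin p) :=
    fun g => -A (clip (θ + B (v g))) with hd
  have hdn : ∀ g, ‖d g‖ ≤ Real.sqrt κMax * Real.sqrt p := fun g => by
    refine abs_le_of_sq_le_sq' ?_ (by positivity) |>.2
    rw [mul_pow, Real.sq_sqrt hκMax, Real.sq_sqrt hp.le, hd, norm_neg]
    refine (h.pair.upper _).trans ?_
    gcongr
    exact norm_clip_sq_le _
  have hdm : AEStronglyMeasurable d (gaussian p) := by
    refine Continuous.comp_aestronglyMeasurable
      (g := fun y : EuclideanSpace ℝ (Fin p) => -A (clip (θ + B y))) ?_ hvL.1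
    have := continuous_clip (p := p)
    fun_prop
  have hdL : MemLp d 2 (gaussian p) :=
    MemLp.of_bound hdm (Real.sqrt κMax * Real.sqrt p) (Filter.Eventually.of_forall hdn)
  have hdT : ‖hdL.toLp d‖ ≤ Real.sqrt κMax * Real.sqrt p := by
    refine abs_le_of_sq_le_sq' ?_ (by positivity) |>.2
    rw [norm_toLp_sq]
    calc ∫ g, ‖d g‖ ^ 2 ∂(gaussian p) ≤ ∫ _g, (Real.sqrt κMax * Real.sqrt p) ^ 2 ∂(gaussian p) :=
          integral_mono ((memLp_two_iff_integrable_sq_norm hdL.1).1 hdL) (integrable_const _)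
            fun g => pow_le_pow_left₀ (norm_nonneg _) (hdn g) 2
      _ = _ := by simp
  have huL : MemLp (fun g => v g + t • d g) 2 (gaussian p) := hvL.add (hdL.const_smul t)
  have huT : huL.toLp _ = v + t • hdL.toLp d := by
    have e : huL.toLp _ = hvL.toLp _ + t • hdL.toLp d := rfl
    rw [e, hvT]
  have hgap : gap σ (1 / (n : ℝ)) (noise p) (v + t • hdL.toLp d) ≤
      gap σ (1 / (n : ℝ)) (noise p) v + t * C := by
    refine (gap_add_le (σ := σ) (g := noise p) (by positivity : 0 ≤ 1 / (n : ℝ)) v _).trans ?_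
    rw [norm_smul, Real.norm_of_nonneg ht]
    have hnn : ‖noise p‖ = Real.sqrt p := by
      rw [← norm_noise_sq (p := p), Real.sqrt_sq (norm_nonneg _)]
    have h1 : (Real.sqrt (1 / (n : ℝ)) + 1 / (n : ℝ) * Real.sqrt p) *
        (Real.sqrt κMax * Real.sqrt p) = C := by
      have e1 := h.sqrt_mul_sqrt hδ
      have e2 : 1 / (n : ℝ) * (Real.sqrt p * Real.sqrt p) = 1 / δ := by
        rw [Real.mul_self_sqrt hp.le, h.n_eq hδ]; field_simp
      rw [hC]
      linear_combination Real.sqrt κMax * e1 + Real.sqrt κMax * e2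
    rw [hnn, ← h1]
    have h2 : 0 ≤ t * (Real.sqrt (1 / (n : ℝ)) + 1 / (n : ℝ) * Real.sqrt p) := by positivity
    have h3 := mul_le_mul_of_nonneg_left hdT h2
    linarith
  have hpen : meanPenalty Cov θ (1 / (n : ℝ)) lam (v + t • hdL.toLp d) ≤
      meanPenalty Cov θ (1 / (n : ℝ)) lam v -
        1 / (n : ℝ) * lam * (t * truncatedSize Cov θ v) := by
    have e1 : meanPenalty Cov θ (1 / (n : ℝ)) lam v =
      1 / (n : ℝ) * lam * ∫ g, penalty Cov θ (v g) ∂(gaussian p) := rfl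
    have e2 : truncatedSize Cov θ v =
        ∫ g, ∑ j, min |θ j + B (v g) j| 1 ∂(gaussian p) := by
      rw [integral_finsetSum _ fun j _ => integrable_min_abs hvL j]; rfl
    have i1 : Integrable (fun g => ∑ j, min |θ j + B (v g) j| 1) (gaussian p) :=
      integrable_finsetSum _ fun j _ => integrable_min_abs hvL j
    have i2 := integrable_penalty (Cov := Cov) (θ := θ) hvL
    have i3 := integrable_penalty (Cov := Cov) (θ := θ) huL
    rw [← huT, meanPenalty_toLp, e1, ← mul_sub, e2, ← integral_const_mul t,
      ← integral_sub i2 (i1.const_mul t)]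
    refine mul_le_mul_of_nonneg_left (integral_mono i3 (i2.sub (i1.const_mul t)) fun g => ?_)
      (by positivity)
    change penalty Cov θ (v g + t • d g) ≤ penalty Cov θ (v g) - t * ∑ j, min |θ j + B (v g) j| 1
    have e3 : θ + B (v g + t • d g) = (θ + B (v g)) - t • clip (θ + B (v g)) := by
      rw [map_add, map_smul, hd, map_neg, h.pair.inv_apply, smul_neg]; abel
    unfold penalty
    rw [e3]
    exact l1Norm_sub_smul_clip_le ht1 _
  have hnear := hv (v + t • hdL.toLp d)
  unfold modelCost cost at hnear
  have hmax : max (gap σ (1 / (n : ℝ)) (noise p) (v + t • hdL.toLp d)) 0 ≤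
      max (gap σ (1 / (n : ℝ)) (noise p) v) 0 + t * C := by
    refine max_le ?_ (by positivity)
    linarith [le_max_left (gap σ (1 / (n : ℝ)) (noise p) v) 0]
  have hsq := pow_le_pow_left₀ (le_max_right _ _) hmax 2
  linarith

/-- By contradiction: a small `gap` forces a small truncated size, hence correlation at most `σMin /
2`, hence `gap` at least `σMin / 2`. -/
lemma exists_gap_bound (hlamMin : 0 < lamMin) (hκMin : 0 < κMin) (hκ : κMin ≤ κMax)
    (hσMin : 0 < σMin) (hδ : 0 < δ) {U : ℝ} :
    ∃ c ε : ℝ, 0 < c ∧ 0 < ε ∧ ε ≤ 1 ∧ ∀ (n p : ℕ) (Cov : Matrix (Fin p) (Fin p) ℝ) (σ lam : ℝ)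
      (θ : EuclideanSpace ℝ (Fin p)),
      IsAdmissible lamMin lamMax κMin κMax σMin σMax δ νMin ΔMin M n Cov σ lam θ →
      ∀ v : ErrorSpace p, Real.sqrt (1 / (n : ℝ)) * ‖v‖ ≤ U →
        (∀ u, modelCost n Cov σ lam θ v ≤ modelCost n Cov σ lam θ u + ε) →
        c ≤ gap σ (1 / (n : ℝ)) (noise p) v := by
  have hκMax : 0 < κMax := hκMin.trans_le hκ
  -- `a`, `b` and `η` make each of the three terms of the correlation bound equal to `T / 3`. Then
  -- `t`, `ε` and `c` make each of the three error terms in the bound on the truncated size at most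
  -- `t * lamMin * η / 3`.
  set T := σMin / 2 with hT
  have hT0 : 0 < T := by positivity
  set W := 9 / δ + 10 * (κMin⁻¹ * U ^ 2) with hW
  have hW0 : 0 < W := by positivity
  set a := 2 * T / (3 * W) with ha
  have ha0 : 0 < a := by positivity
  set Q := 48 * Real.exp (κMax / 2) with hQ
  have hQ0 : 0 < Q := by positivity
  set b := 4 * a * δ * T / (3 * Q) with hb
  have hb0 : 0 < b := by positivity
  set R := 2 * κMax + 1 / (2 * b) with hR
  have hR0 : 0 < R := by positivity
  set η := 2 * a * T / (3 * R) with hη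
  have hη0 : 0 < η := by positivity
  set C := Real.sqrt κMax * (1 / Real.sqrt δ + 1 / δ) with hC
  have hC0 : 0 < C := by positivity
  set t := min 1 (2 * lamMin * η / (3 * C ^ 2)) with ht
  have ht0 : 0 < t := by positivity
  set ε := min 1 (t * (lamMin * η / 3)) with hε
  have hε0 : 0 < ε := by positivity
  set c := min T (lamMin * η / (3 * C)) with hc
  have hc0 : 0 < c := by positivity
  refine ⟨c, ε, hc0, hε0, min_le_left _ _, ?_⟩
  intro n p Cov σ lam θ h v hvU hv
  have hp := h.p_pos hδ
  have hn := h.n_pos hδ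
  by_contra! hlt
  have hD0 : 0 ≤ truncatedSize Cov θ v :=
    Finset.sum_nonneg fun j _ => integral_nonneg fun g => le_min (abs_nonneg _) zero_le_one
  have hD : 1 / (n : ℝ) * truncatedSize Cov θ v ≤ η := by
    have h1 := h.truncatedSize_le hlamMin hδ hκMax.le hv ht0.le (min_le_left _ _)
    rw [← hC] at h1
    have h2 : max (gap σ (1 / (n : ℝ)) (noise p) v) 0 ≤ lamMin * η / (3 * C) :=
      max_le (hlt.le.trans (min_le_right _ _)) (by positivity)
    have h3 : t * C * max (gap σ (1 / (n : ℝ)) (noise p) v) 0 ≤ t * (lamMin * η / 3) := by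
      calc _ ≤ t * C * (lamMin * η / (3 * C)) := by gcongr
        _ = _ := by field_simp
    have h4 : t ^ 2 * C ^ 2 / 2 ≤ t * (lamMin * η / 3) := by
      have : t ≤ 2 * lamMin * η / (3 * C ^ 2) := min_le_right _ _
      calc t ^ 2 * C ^ 2 / 2 = t * (t * C ^ 2 / 2) := by ring
        _ ≤ t * (2 * lamMin * η / (3 * C ^ 2) * C ^ 2 / 2) := by gcongr
        _ = _ := by field_simp
    have h5 : ε ≤ t * (lamMin * η / 3) := min_le_right _ _
    have h6 : t * lamMin * (1 / (n : ℝ) * truncatedSize Cov θ v) ≤ t * lamMin * η := by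
      calc _ ≤ t * lam * (1 / (n : ℝ) * truncatedSize Cov θ v) := by
            have := h.lam_lower
            gcongr
        _ = 1 / (n : ℝ) * lam * (t * truncatedSize Cov θ v) := by ring
        _ ≤ _ := by linarith
    exact le_of_mul_le_mul_left h6 (by positivity)
  have hU2 : 1 / (n : ℝ) * ‖v‖ ^ 2 ≤ U ^ 2 := by
    have := pow_le_pow_left₀ (by positivity) hvU 2
    rwa [mul_pow, Real.sq_sqrt (by positivity)] at this
  have hpn : 1 / (n : ℝ) * p = 1 / δ := by rw [h.n_eq hδ]; field_simp
  have hcorr : 1 / (n : ℝ) * inner ℝ (noise p) v ≤ T := by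
    have h1 := inner_noise_le (θ := θ) h.pair hκMin ha0 hb0 v
    rw [← hQ, ← hR] at h1
    calc 1 / (n : ℝ) * inner ℝ (noise p) v
        ≤ 1 / (n : ℝ) * (a / 2 * (9 * p + 10 * (κMin⁻¹ * ‖v‖ ^ 2)) +
          1 / (2 * a) * (truncatedSize Cov θ v * R + b / 2 * Q * p)) := by gcongr
      _ = a / 2 * (9 * (1 / (n : ℝ) * p) + 10 * (κMin⁻¹ * (1 / (n : ℝ) * ‖v‖ ^ 2))) +
          1 / (2 * a) * ((1 / (n : ℝ) * truncatedSize Cov θ v) * R +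
            b / 2 * Q * (1 / (n : ℝ) * p)) := by ring
      _ ≤ a / 2 * (9 * (1 / δ) + 10 * (κMin⁻¹ * U ^ 2)) +
          1 / (2 * a) * (η * R + b / 2 * Q * (1 / δ)) := by
          rw [hpn]; gcongr
      _ = a / 2 * W + 1 / (2 * a) * (η * R) + 1 / (2 * a) * (b / 2 * Q * (1 / δ)) := by
          rw [hW]; ring
      _ = T / 3 + T / 3 + T / 3 := by
          congr 1
          · congr 1
            · rw [ha]; field_simp
            · rw [hη]; field_simp
          · rw [hb]; field_simp; norm_num
      _ = T := by ring
  have hnl : σMin ≤ noiseLevel σ (1 / (n : ℝ)) v := by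
    refine Real.le_sqrt_of_sq_le ?_
    have := h.noise_lower
    have h2 : 0 ≤ 1 / (n : ℝ) * ‖v‖ ^ 2 := by positivity
    linarith
  have hgap : T ≤ gap σ (1 / (n : ℝ)) (noise p) v := by
    rw [gap]; linarith
  linarith [min_le_left T (lamMin * η / (3 * C))]

end Bounds

end LassoFixedDesign

/-! ### The theorem. -/

theorem theorem2
    (lamMin lamMax κMin κMax σMin σMax : ℝ)
    (hlamMin : 0 < lamMin) (hlam : lamMin ≤ lamMax)
    (hκMin : 0 < κMin) (hκ : κMin ≤ κMax)
    (hσMin : 0 < σMin) (hσ : σMin ≤ σMax)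
    (δ νMin ΔMin M : ℝ)
    (hδ : 0 < δ) (hνMin : 0 < νMin) (hΔMin : 0 < ΔMin) (hΔMin1 : ΔMin ≤ 1) (hM : 0 ≤ M) :
    ∃ τMin τMax ζMin ζMax : ℝ,
      0 < τMin ∧ τMin ≤ τMax ∧ 0 < ζMin ∧ ζMin ≤ ζMax ∧
      ∀ (n p : ℕ) (_ : (n : ℝ) / (p : ℝ) = δ)
        (Cov : Matrix (Fin p) (Fin p) ℝ) (hCov : Cov.PosSemidef)
        (_ : ∀ j, κMin ≤ hCov.isHermitian.eigenvalues j ∧ hCov.isHermitian.eigenvalues j ≤ κMax)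
        (lam : ℝ) (_ : lamMin ≤ lam) (_ : lam ≤ lamMax)
        (σ : ℝ) (_ : σMin ^ 2 ≤ σ ^ 2) (_ : σ ^ 2 ≤ σMax ^ 2)
        (θ : EuclideanSpace ℝ (Fin p))
        (s : ℕ) (_ : νMin ≤ (s : ℝ) / (p : ℝ))
        (_ : LassoFixedDesign.IsApproxSparse Cov θ s (Real.sqrt δ * (1 - ΔMin)) M),
        ∃ τ ζ : ℝ,
          LassoFixedDesign.IsFixedPoint n Cov σ lam θ τ ζ ∧
          (∀ τ' ζ' : ℝ, LassoFixedDesign.IsFixedPoint n Cov σ lam θ τ' ζ' → τ' = τ ∧ ζ' = ζ) ∧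
          τMin ≤ τ ∧ τ ≤ τMax ∧ ζMin ≤ ζ ∧ ζ ≤ ζMax := by
  obtain ⟨U, hU0, hU⟩ := LassoFixedDesign.exists_norm_bound (κMax := κMax) (σMax := σMax)
    (σMin := σMin) hlamMin hlam hκMin hδ hνMin hΔMin hΔMin1 hM
  obtain ⟨c, ε, hc, hε, hε1, hgap⟩ := LassoFixedDesign.exists_gap_bound (lamMax := lamMax)
    (σMax := σMax) (νMin := νMin) (ΔMin := ΔMin) (M := M) (U := U) hlamMin hκMin hκ hσMin hδ
  set τMax := Real.sqrt (σMax ^ 2 + U ^ 2) with hτMax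
  have hτσ : σMin ≤ τMax := by
    refine Real.le_sqrt_of_sq_le ?_
    have := pow_le_pow_left₀ hσMin.le hσ 2
    nlinarith [sq_nonneg U]
  have hτMax0 : 0 < τMax := hσMin.trans_le hτσ
  -- `ζ` is the ratio of `gap` to the noise level, so it is at least `c / τMax`, and Cauchy–Schwarz
  -- bounds it by `1 + 1/√δ`. The maximum only serves to guarantee `ζMin ≤ ζMax`.
  refine ⟨σMin, τMax, c / τMax, max (c / τMax) (1 + 1 / Real.sqrt δ), hσMin, hτσ, by positivity,
    le_max_left _ _, ?_⟩
  intro n p hnp Cov hCov heig lam hlam1 hlam2 σ hσ1 hσ2 θ s hs hsparse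
  have hpair := LassoFixedDesign.isSymmInversePair_sqrt hCov hκMin heig
  have h : LassoFixedDesign.IsAdmissible lamMin lamMax κMin κMax σMin σMax δ νMin ΔMin M n Cov σ
      lam θ := ⟨hnp, hpair, hlam1, hlam2, hσ1, hσ2, s, hs, hsparse⟩
  have hn := h.n_pos hδ
  have hn' : 0 < n := by exact_mod_cast hn
  have hr : 0 < 1 / (n : ℝ) := by positivity
  have hlam0 : 0 < lam := hlamMin.trans_le hlam1
  have hσ0 : 0 < σ ^ 2 := (by positivity : 0 < σMin ^ 2).trans_le hσ1
  have hbound : ∀ v, (∀ u, LassoFixedDesign.modelCost n Cov σ lam θ v ≤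
      LassoFixedDesign.modelCost n Cov σ lam θ u + ε) → Real.sqrt (1 / (n : ℝ)) * ‖v‖ ≤ U :=
    fun v hv => hU n p Cov σ lam θ h v ((hv 0).trans (by linarith))
  have hgap' : ∀ v, (∀ u, LassoFixedDesign.modelCost n Cov σ lam θ v ≤
      LassoFixedDesign.modelCost n Cov σ lam θ u + ε) →
      c ≤ LassoFixedDesign.gap σ (1 / (n : ℝ)) (LassoFixedDesign.noise p) v :=
    fun v hv => hgap n p Cov σ lam θ h v (hbound v hv) hv
  obtain ⟨v, hv⟩ := LassoFixedDesign.exists_minimizer_cost (σ := σ) (g := LassoFixedDesign.noise p)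
    (U := U / Real.sqrt (1 / (n : ℝ))) hσ0 hr
    (LassoFixedDesign.convexOn_meanPenalty (Cov := Cov) (θ := θ) hr.le hlam0.le)
    (LassoFixedDesign.continuous_meanPenalty hr.le hlam0.le)
    (LassoFixedDesign.meanPenalty_nonneg hr.le hlam0.le) hc hε
    (fun v hv => by
      rw [le_div_iff₀ (Real.sqrt_pos.2 hr)]
      linarith [hbound v hv]) hgap'
  have hv' : ∀ u, LassoFixedDesign.modelCost n Cov σ lam θ v ≤
      LassoFixedDesign.modelCost n Cov σ lam θ u + ε := fun u => (hv u).trans (by linarith)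
  have hvU := hbound v hv'
  have hvc := hgap' v hv'
  have hfp := LassoFixedDesign.isFixedPoint_of_isMin hn' hσ0 hpair hlam0 hv (hc.trans_le hvc)
  have hτ0 := LassoFixedDesign.noiseLevel_pos hσ0 hr.le v
  have hτle : LassoFixedDesign.noiseLevel σ (1 / (n : ℝ)) v ≤ τMax := by
    rw [hτMax, LassoFixedDesign.noiseLevel]
    have hvU2 := pow_le_pow_left₀ (by positivity) hvU 2
    rw [mul_pow, Real.sq_sqrt hr.le] at hvU2
    exact Real.sqrt_le_sqrt (by linarith)
  refine ⟨_, _, hfp, fun τ' ζ' h' => hfp.unique hn' hσ0 hpair hlam0 h', ?_, hτle, ?_, ?_⟩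
  · refine Real.le_sqrt_of_sq_le ?_
    have : 0 ≤ 1 / (n : ℝ) * ‖v‖ ^ 2 := by positivity
    linarith
  · exact div_le_div₀ (hc.le.trans hvc) hvc hτ0 hτle
  · refine le_trans ?_ (le_max_right _ _)
    rw [div_le_iff₀ hτ0]
    have h1 := abs_le.1 (abs_real_inner_le_norm (LassoFixedDesign.noise p) v)
    have hnn : ‖LassoFixedDesign.noise p‖ = Real.sqrt p := by
      rw [← LassoFixedDesign.norm_noise_sq (p := p), Real.sqrt_sq (norm_nonneg _)]
    have h2 := LassoFixedDesign.sqrt_mul_norm_le_noiseLevel (σ := σ) hr.le v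
    have h3 : 1 / (n : ℝ) * (‖LassoFixedDesign.noise p‖ * ‖v‖) ≤
        1 / Real.sqrt δ * LassoFixedDesign.noiseLevel σ (1 / (n : ℝ)) v := by
      have e : 1 / (n : ℝ) * (‖LassoFixedDesign.noise p‖ * ‖v‖) =
          1 / Real.sqrt δ * (Real.sqrt (1 / (n : ℝ)) * ‖v‖) := by
        rw [← h.sqrt_mul_sqrt hδ, hnn]
        linear_combination (-(Real.sqrt p * ‖v‖)) * Real.mul_self_sqrt hr.le
      rw [e]; gcongr
    have h4 := mul_le_mul_of_nonneg_left h1.1 hr.le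
    rw [LassoFixedDesign.gap]
    linarith
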